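/- **Theorem 5.1.** All graphs are finite and simple. A graph is *co-gem-free* if it has no induced subgraph isomorphic to the disjoint union of the path $P_4$ and a single vertex. Let $C$ be a finite non-empty set of colours and $t\colon V(G)\to C$ a *template* for a graph $G$. A *stroke* is a pair $(A,c)$ of a set $A\subseteq V(G)$ that is connected in $G$ (any two vertices of $A$ are joined by a path inside $A$) and a colour $c\in C$; it gives all vertices of $A$ the colour $c$ and changes no other vertex. A *paint plan* for $(G,t)$ is a non-empty sequence of strokes that, applied one after the other to the unpainted graph $G$, produces exactly $t$; it is *optimal* if no paint plan for $(G,t)$ has fewer strokes. (a) There is a polynomial-time algorithm that, given a co-gem-free graph $G$ and a template $t$ for $G$, outputs an optimal paint plan for $(G,t)$. In the game *Free Flood-It*, a *move* $(v,c)$ with $v\in V(G)$, $c\in C$ on a graph with a colouring $p\colon V(G)\to C$ gives the colour $c$ to all vertices $w$ such that $G$ has a path from $v$ to $w$ on which $p$ is constant. A *flooding sequence* for $(G,t)$ is a (possibly empty) sequence of moves that, starting from the colouring $t$, ends in a constant colouring; it is *optimal* if no flooding sequence for $(G,t)$ has fewer moves. (b) There is a polynomial-time algorithm that, given a co-gem-free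 graph $G$ and a colouring $t$ of $G$, outputs an optimal flooding sequence for $(G,t)$. Here $V(G)=\{0,\dots,n-1\}$, $C=\{0,\dots,k-1\}$, the input consists of the adjacency matrix of $G$ and the list of the colours $t(0),\dots,t(n-1)$ in binary, and the running time is bounded by a fixed polynomial in the length of the input. -/

import Mathlib

namespace Painting

/-! ### Graphs without induced co-gems -/

/-- The co-gem: the path on four vertices together with one isolated vertex. -/
def coGem : SimpleGraph (Fin 4 ⊕ Fin 1) :=
  SimpleGraph.sum (SimpleGraph.pathGraph 4) ⊥

/-- No induced subgraph of `G` is isomorphic to the co-gem. -/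
def CoGemFree {V : Type*} (G : SimpleGraph V) : Prop :=
  ¬ coGem.IsIndContained G

/-! ### Painting a graph -/

/-- A brush stroke: an area and the colour that it receives. -/
structure Stroke (V C : Type*) where
  area : Finset V
  color : C

/-- The painting after a stroke. A painting is a partial colouring, `none` meaning unpainted. -/
def Stroke.apply {V C : Type*} [DecidableEq V] (p : V → Option C) (s : Stroke V C) :
    V → Option C :=
  fun v => if v ∈ s.area then some s.color else p v

/-- `P` is a non-empty sequence of strokes on connected areas which turns the unpainted graph `G`
into the graph painted with the template `t`. A vertex set is connected if any two of its vertices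
are joined by a path inside the set (so the empty set is connected; an empty stroke has no
effect). -/
def IsPaintPlan {V C : Type*} [DecidableEq V] (G : SimpleGraph V) (t : V → C)
    (P : List (Stroke V C)) : Prop :=
  P ≠ [] ∧
  (∀ s ∈ P, (G.induce (s.area : Set V)).Preconnected) ∧
  P.foldl Stroke.apply (fun _ => none) = fun v => some (t v)

/-- A paint plan with the least number of strokes. -/
def IsOptimalPaintPlan {V C : Type*} [DecidableEq V] (G : SimpleGraph V) (t : V → C)
    (P : List (Stroke V C)) : Prop :=
  IsPaintPlan G t P ∧ ∀ Q : List (Stroke V C), IsPaintPlan G t Q → P.length ≤ Q.length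

/-! ### Free Flood-It -/

/-- A move: a pivot vertex and a flooding colour. -/
structure Move (V C : Type*) where
  pivot : V
  color : C

/-- The edges of `G` whose ends have equal colours. Its connected components are the
colour components of `G` with respect to `p`. -/
def sameColorGraph {V C : Type*} (G : SimpleGraph V) (p : V → C) : SimpleGraph V where
  Adj u v := G.Adj u v ∧ p u = p v
  symm := ⟨fun _ _ h => ⟨h.1.symm, h.2.symm⟩⟩
  loopless := ⟨fun _ h => G.irrefl h.1⟩

open Classical in
/-- The colouring after a move: the colour component of the pivot receives the flooding colour. -/
noncomputable def Move.apply {V C : Type*} (G : SimpleGraph V) (p : V → C) (m : Move V C) :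
    V → C :=
  fun v => if (sameColorGraph G p).Reachable m.pivot v then m.color else p v

/-- The sequence of moves `S` makes `G`, initially coloured by `t`, monochromatic. -/
def IsFloodingSequence {V C : Type*} (G : SimpleGraph V) (t : V → C)
    (S : List (Move V C)) : Prop :=
  ∀ u v : V, S.foldl (Move.apply G) t u = S.foldl (Move.apply G) t v

/-- A flooding sequence with the least number of moves. -/
def IsOptimalFloodingSequence {V C : Type*} (G : SimpleGraph V) (t : V → C)
    (S : List (Move V C)) : Prop :=
  IsFloodingSequence G t S ∧
  ∀ S' : List (Move V C), IsFloodingSequence G t S' → S.length ≤ S'.length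

/-! ### The machine model: programs on binary trees, with running time -/

/-- The data of programs: finite binary trees (nested Lisp pairs over one atom). -/
inductive Data where
  | nil : Data
  | cons : Data → Data → Data

namespace Data

/-- The number of nodes of a tree. -/
def size : Data → ℕ
  | nil => 1
  | cons a b => 1 + a.size + b.size

/-- The first component of a pair; `nil` for the atom. -/
def fst : Data → Data
  | nil => nil
  | cons a _ => a

/-- The second component of a pair; `nil` for the atom. -/
def snd : Data → Data
  | nil => nil
  | cons _ b => b

/-- Truth values: false is `nil`, true is `cons nil nil`. -/
def ofBool : Bool → Data
  | false => nil
  | true => cons nil nil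

/-- Lists, in the Lisp way. -/
def ofList : List Data → Data
  | [] => nil
  | a :: l => cons a (ofList l)

/-- Natural numbers in binary, least significant bit first. -/
def ofNat (m : ℕ) : Data :=
  ofList (m.bits.map ofBool)

end Data

/-- Deterministic programs; each takes one tree as its input. In tests, `nil` is false and every
other tree is true. -/
inductive Prog where
  /-- return the input -/
  | id : Prog
  /-- return the atom -/
  | nil : Prog
  /-- return the first component of the input -/
  | fst : Prog
  /-- return the second component of the input -/
  | snd : Prog
  /-- test whether both components of the input are equal -/
  | eq : Prog
  /-- run both programs on the input and return the pair of their results -/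
  | pair : Prog → Prog → Prog
  /-- `comp f g`: run `g` on the input, then `f` on the result -/
  | comp : Prog → Prog → Prog
  /-- `cond b f g`: if `b` returns true on the input then run `f`, else run `g`, on the input -/
  | cond : Prog → Prog → Prog → Prog
  /-- `loop b f`: as long as `b` returns true on the current tree, replace this tree by the
  result of `f` on it -/
  | loop : Prog → Prog → Prog

/-- `Runs P x y c`: on input `x`, the program `P` halts with output `y`, in time `c`. Every
execution of an instruction takes as much time as its input has nodes (so a Turing machine
holding trees as bracket words simulates a run in time polynomial in `c`, even though it has to
copy and compare trees symbol by symbol). -/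
inductive Prog.Runs : Prog → Data → Data → ℕ → Prop
  | id (x : Data) : Runs Prog.id x x x.size
  | nil (x : Data) : Runs Prog.nil x Data.nil x.size
  | fst (x : Data) : Runs Prog.fst x x.fst x.size
  | snd (x : Data) : Runs Prog.snd x x.snd x.size
  | eq_true (x : Data) (h : x.fst = x.snd) : Runs Prog.eq x (Data.ofBool true) x.size
  | eq_false (x : Data) (h : x.fst ≠ x.snd) : Runs Prog.eq x (Data.ofBool false) x.size
  | pair {f g : Prog} {x y z : Data} {a b : ℕ} (hf : Runs f x y a) (hg : Runs g x z b) :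
      Runs (Prog.pair f g) x (Data.cons y z) (x.size + a + b)
  | comp {f g : Prog} {x y z : Data} {a b : ℕ} (hg : Runs g x y a) (hf : Runs f y z b) :
      Runs (Prog.comp f g) x z (x.size + a + b)
  | cond_true {b f g : Prog} {x u y : Data} {a c : ℕ} (hb : Runs b x u a) (hu : u ≠ Data.nil)
      (hf : Runs f x y c) : Runs (Prog.cond b f g) x y (x.size + a + c)
  | cond_false {b f g : Prog} {x y : Data} {a c : ℕ} (hb : Runs b x Data.nil a)
      (hg : Runs g x y c) : Runs (Prog.cond b f g) x y (x.size + a + c)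
  | loop_stop {b f : Prog} {x : Data} {a : ℕ} (hb : Runs b x Data.nil a) :
      Runs (Prog.loop b f) x x (x.size + a)
  | loop_step {b f : Prog} {x u y z : Data} {a c d : ℕ} (hb : Runs b x u a)
      (hu : u ≠ Data.nil) (hf : Runs f x y c) (hl : Runs (Prog.loop b f) y z d) :
      Runs (Prog.loop b f) x z (x.size + a + c + d)

/-- The output and the running time of a program are determined by its input. -/
theorem Prog.Runs.unique {P : Prog} {x y : Data} {c : ℕ} (h : P.Runs x y c) :
    ∀ {y' : Data} {c' : ℕ}, P.Runs x y' c' → y = y' ∧ c = c' := by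
  induction h with
  | id | nil | fst | snd => intro y' c' h'; cases h'; exact ⟨rfl, rfl⟩
  | eq_true x h | eq_false x h => intro y' c' h'; cases h' <;> first | exact ⟨rfl, rfl⟩ | contradiction
  | pair hf hg ihf ihg =>
    intro y' c' h'
    cases h' with
    | pair hf' hg' =>
      obtain ⟨rfl, rfl⟩ := ihf hf'
      obtain ⟨rfl, rfl⟩ := ihg hg'
      exact ⟨rfl, rfl⟩
  | comp hg hf ihg ihf =>
    intro y' c' h'
    cases h' with
    | comp hg' hf' =>
      obtain ⟨rfl, rfl⟩ := ihg hg'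
      obtain ⟨rfl, rfl⟩ := ihf hf'
      exact ⟨rfl, rfl⟩
  | cond_true hb hu hf ihb ihf =>
    intro y' c' h'
    cases h' with
    | cond_true hb' hu' hf' =>
      obtain ⟨rfl, rfl⟩ := ihb hb'
      obtain ⟨rfl, rfl⟩ := ihf hf'
      exact ⟨rfl, rfl⟩
    | cond_false hb' hg' => exact absurd (ihb hb').1 hu
  | cond_false hb hg ihb ihg =>
    intro y' c' h'
    cases h' with
    | cond_true hb' hu' hf' => exact absurd (ihb hb').1.symm hu'
    | cond_false hb' hg' =>
      obtain ⟨-, rfl⟩ := ihb hb'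
      obtain ⟨rfl, rfl⟩ := ihg hg'
      exact ⟨rfl, rfl⟩
  | loop_stop hb ihb =>
    intro y' c' h'
    cases h' with
    | loop_stop hb' =>
      obtain ⟨-, rfl⟩ := ihb hb'
      exact ⟨rfl, rfl⟩
    | loop_step hb' hu' hf' hl' => exact absurd (ihb hb').1.symm hu'
  | loop_step hb hu hf hl ihb ihf ihl =>
    intro y' c' h'
    cases h' with
    | loop_stop hb' => exact absurd (ihb hb').1 hu
    | loop_step hb' hu' hf' hl' =>
      obtain ⟨rfl, rfl⟩ := ihb hb'
      obtain ⟨rfl, rfl⟩ := ihf hf'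
      obtain ⟨rfl, rfl⟩ := ihl hl'
      exact ⟨rfl, rfl⟩

/-! ### Inputs and outputs as data -/

open Classical in
/-- A set of vertices as its characteristic bit vector. -/
noncomputable def encodeSet {n : ℕ} (A : Set (Fin n)) : Data :=
  Data.ofList (List.ofFn fun v => Data.ofBool (decide (v ∈ A)))

/-- A graph with a template: the adjacency matrix, as the list of its rows, paired with the list
of the colours of the vertices, in binary. -/
noncomputable def encodeInstance {n k : ℕ} (G : SimpleGraph (Fin n)) (t : Fin n → Fin k) : Data :=
  Data.cons
    (Data.ofList (List.ofFn fun u => encodeSet (G.neighborSet u)))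
    (Data.ofList (List.ofFn fun v => Data.ofNat (t v)))

/-- A sequence of strokes: the list of the pairs of an area and a colour. -/
noncomputable def encodePlan {n k : ℕ} (P : List (Stroke (Fin n) (Fin k))) : Data :=
  Data.ofList (P.map fun s => Data.cons (encodeSet (s.area : Set (Fin n))) (Data.ofNat s.color))

/-- A sequence of moves: the list of the pairs of a pivot and a colour. -/
def encodeMoves {n k : ℕ} (S : List (Move (Fin n) (Fin k))) : Data :=
  Data.ofList (S.map fun m => Data.cons (Data.ofNat m.pivot) (Data.ofNat m.color))

end Painting

/-!
Read a paint plan backwards in time. The last stroke is a connected set of one colour in the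
template; vertices that later strokes repaint are wild cards for the earlier ones. So a state of
the reversed process is just the set `W` of finished vertices, and a stroke with the colour `c`
and a pivot `v` of that colour may as well finish the whole component of `v` in the graph induced
by `W` and the colour class `c` (`step`). The least number of strokes which turn a canvas with
given base colours into the template `t` is therefore the least length of a list of pivots whose
`run` from the empty set finishes all vertices where `t` differs from the canvas
(`exists_pivots_of_strokes`, `foldl_pivotStrokes`). For paint plans, these are all vertices.

Free Flood-It fits into the same frame: flooding `t` until it has the colour `c` everywhere takes
exactly as many moves as painting `t` on a canvas of colour `c` takes strokes. Undoing a move is a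
stroke (`exists_strokes_of_moves`). Conversely, one more stroke costs at most one more move
(`exists_moves_of_agree`). So the number of moves is the minimum over `c` of the least number of
pivots that finish all vertices of colours other than `c`, and an optimal flooding sequence is
found by trying all moves and taking one that decreases this number.

It remains to find a shortest list of pivots that finishes a union `T` of colour classes. `step` is
monotone in `W`, and components of the graph are independent of each other (`cover_spec`). Within
a component, each pivot completes at most one colour, so a list of pivots has as many elements as
there are colours in `T`, plus the number of pivots that do not complete a colour. A pivot that
completes a colour may be used at once, since that colour needs a pivot anyway
(`exists_pivot_of_not_subset`). Connected co-gem-free graphs have a connected dominating set with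
at most four vertices (`CoGemFree.exists_dominating`): an induced path on four vertices dominates
the graph, and without such a path an edge or a vertex does. As soon as these vertices are
finished, each colour needs just one more pivot (`exists_pivots_of_dominating`). So at most four
pivots do not complete a colour, and a search over all choices for them, completing colours
greedily in between, takes polynomial time (`best`, `best_spec`).

The algorithm is a function on lists of booleans and numbers. That it runs in polynomial time
follows from closure properties of the functions computed by programs in polynomial time
(`PolyTime`), the main one being that lists may be folded as long as the intermediate states have
polynomial size (`PolyTime.foldl_of_prefix`).
-/

namespace Painting

/-! ### Functions computable in polynomial time -/

theorem eval_le_eval (q : Polynomial ℕ) {a b : ℕ} (h : a ≤ b) : q.eval a ≤ q.eval b := by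
  rw [Polynomial.eval_eq_sum_range, Polynomial.eval_eq_sum_range]
  gcongr

theorem Data.one_le_size (x : Data) : 1 ≤ x.size := by
  cases x <;> simp only [Data.size] <;> omega

/-- Time bounds the size of the output. -/
theorem Prog.Runs.size_le {P : Prog} {x y : Data} {c : ℕ} (h : P.Runs x y c) :
    y.size ≤ 3 * c := by
  induction h with
  | id x => omega
  | nil x => have := x.one_le_size; simp only [Data.size]; omega
  | fst x => cases x <;> simp only [Data.fst, Data.size] <;> omega
  | snd x => cases x <;> simp only [Data.snd, Data.size] <;> omega
  | eq_true x _ => have := x.one_le_size; simp only [Data.ofBool, Data.size]; omega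
  | eq_false x _ => have := x.one_le_size; simp only [Data.ofBool, Data.size]; omega
  | @pair f g x y z a b _ _ _ _ =>
    have := x.one_le_size
    simp only [Data.size]; omega
  | comp => omega
  | cond_true => omega
  | cond_false => omega
  | loop_stop => omega
  | loop_step => omega

/-- One program computes `y i` from `x i`, in time polynomial in the size of `x i`, for every
index `i`. -/
def Computes {ι : Type*} (x y : ι → Data) : Prop :=
  ∃ (P : Prog) (q : Polynomial ℕ), ∀ i, ∃ c ≤ q.eval (x i).size, P.Runs (x i) (y i) c

namespace Computes

variable {ι : Type*} {x y z u : ι → Data}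

theorem id : Computes x x :=
  ⟨Prog.id, Polynomial.X, fun i => ⟨(x i).size, by simp, .id _⟩⟩

theorem congr (h : Computes x y) (e : ∀ i, y i = z i) : Computes x z := by
  rwa [show z = y from (funext e).symm]

theorem nil : Computes x fun _ => Data.nil :=
  ⟨Prog.nil, Polynomial.X, fun i => ⟨(x i).size, by simp, .nil _⟩⟩

theorem comp (hg : Computes x y) (hf : Computes y z) : Computes x z := by
  obtain ⟨P, p, hP⟩ := hg
  obtain ⟨Q, q, hQ⟩ := hf
  refine ⟨Prog.comp Q P, Polynomial.X + p + q.comp (3 * p), fun i => ?_⟩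
  obtain ⟨a, ha, hPa⟩ := hP i
  obtain ⟨b, hb, hQb⟩ := hQ i
  refine ⟨_, ?_, .comp hPa hQb⟩
  have h1 : q.eval (y i).size ≤ q.eval (3 * p.eval (x i).size) :=
    eval_le_eval q (hPa.size_le.trans (by omega))
  simp only [Polynomial.eval_add, Polynomial.eval_X, Polynomial.eval_comp, Polynomial.eval_mul,
    Polynomial.eval_ofNat]
  omega

theorem pair (hf : Computes x y) (hg : Computes x z) :
    Computes x fun i => Data.cons (y i) (z i) := by
  obtain ⟨P, p, hP⟩ := hf
  obtain ⟨Q, q, hQ⟩ := hg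
  refine ⟨Prog.pair P Q, Polynomial.X + p + q, fun i => ?_⟩
  obtain ⟨a, ha, hPa⟩ := hP i
  obtain ⟨b, hb, hQb⟩ := hQ i
  refine ⟨_, ?_, .pair hPa hQb⟩
  simp only [Polynomial.eval_add, Polynomial.eval_X]
  omega

theorem fst (hf : Computes x y) : Computes x fun i => (y i).fst :=
  hf.comp ⟨Prog.fst, Polynomial.X, fun i => ⟨(y i).size, by simp, .fst _⟩⟩

theorem snd (hf : Computes x y) : Computes x fun i => (y i).snd :=
  hf.comp ⟨Prog.snd, Polynomial.X, fun i => ⟨(y i).size, by simp, .snd _⟩⟩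

open Classical in
theorem eq (hf : Computes x y) (hg : Computes x z) :
    Computes x fun i => Data.ofBool (decide (y i = z i)) := by
  refine (hf.pair hg).comp ⟨Prog.eq, Polynomial.X, fun i => ⟨_, le_of_eq (by simp; rfl), ?_⟩⟩
  by_cases h : y i = z i
  · simpa [h] using Prog.Runs.eq_true (Data.cons (y i) (z i)) h
  · simpa [h] using Prog.Runs.eq_false (Data.cons (y i) (z i)) h

open Classical in
theorem cond (hb : Computes x u) (hf : Computes x y) (hg : Computes x z) :
    Computes x fun i => if u i = Data.nil then z i else y i := by
  obtain ⟨B, r, hB⟩ := hb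
  obtain ⟨P, p, hP⟩ := hf
  obtain ⟨Q, q, hQ⟩ := hg
  refine ⟨Prog.cond B P Q, Polynomial.X + r + p + q, fun i => ?_⟩
  obtain ⟨d, hd, hBd⟩ := hB i
  obtain ⟨a, ha, hPa⟩ := hP i
  obtain ⟨b, hb, hQb⟩ := hQ i
  by_cases h : u i = Data.nil
  · rw [h] at hBd
    refine ⟨_, ?_, by simpa only [h, if_true] using Prog.Runs.cond_false (f := P) hBd hQb⟩
    simp only [Polynomial.eval_add, Polynomial.eval_X]
    omega
  · refine ⟨_, ?_, by simpa only [h, if_false] using Prog.Runs.cond_true (g := Q) hBd h hPa⟩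
    simp only [Polynomial.eval_add, Polynomial.eval_X]
    omega

theorem const (d : Data) : Computes x fun _ => d := by
  induction d with
  | nil => exact nil
  | cons a b ha hb => exact ha.pair hb

end Computes

/-- An encoding of the elements of a type as data. -/
class Enc (α : Type*) where
  enc : α → Data
  inj : Function.Injective enc

open Enc

/-- The number of nodes of the encoding. -/
def sz {α : Type*} [Enc α] (a : α) : ℕ := (enc a).size

instance : Enc Bool := ⟨Data.ofBool, by intro a b h; cases a <;> cases b <;> simp_all [Data.ofBool]⟩

theorem Data.ofList_injective : Function.Injective Data.ofList := by
  intro l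
  induction l with
  | nil => intro m h; cases m <;> simp_all [Data.ofList]
  | cons a l ih =>
    intro m h
    cases m with
    | nil => simp [Data.ofList] at h
    | cons b m =>
      simp only [Data.ofList, Data.cons.injEq] at h
      rw [h.1, ih h.2]

instance {α : Type*} [Enc α] : Enc (List α) :=
  ⟨fun l => Data.ofList (l.map enc), fun _ _ h =>
    List.map_injective_iff.2 Enc.inj (Data.ofList_injective h)⟩

instance {α β : Type*} [Enc α] [Enc β] : Enc (α × β) :=
  ⟨fun p => Data.cons (enc p.1) (enc p.2), fun a b h => by
    simp only [Data.cons.injEq] at h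
    exact Prod.ext (Enc.inj h.1) (Enc.inj h.2)⟩

theorem bits_injective : Function.Injective Nat.bits := by
  intro a b h
  have (m : ℕ) : (m.bits.foldr (fun c k => Nat.bit c k) 0) = m := by
    induction m using Nat.binaryRec' with
    | zero => simp
    | bit c m hm ih => rw [Nat.bits_append_bit m c hm, List.foldr_cons, ih]
  rw [← this a, ← this b, h]

instance : Enc ℕ :=
  ⟨Data.ofNat, fun _ _ h => bits_injective (List.map_injective_iff.2 (Enc.inj (α := Bool))
    (Data.ofList_injective h))⟩

theorem enc_prod {α β : Type*} [Enc α] [Enc β] (a : α) (b : β) :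
    enc (a, b) = Data.cons (enc a) (enc b) := rfl

theorem enc_cons {α : Type*} [Enc α] (a : α) (l : List α) :
    enc (a :: l) = Data.cons (enc a) (enc l) := rfl

theorem sz_prod {α β : Type*} [Enc α] [Enc β] (a : α) (b : β) : sz (a, b) = 1 + sz a + sz b := rfl

theorem sz_nil {α : Type*} [Enc α] : sz ([] : List α) = 1 := rfl

theorem sz_cons {α : Type*} [Enc α] (a : α) (l : List α) : sz (a :: l) = 1 + sz a + sz l := rfl

theorem one_le_sz {α : Type*} [Enc α] (a : α) : 1 ≤ sz a := Data.one_le_size _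

theorem sz_bool_le (b : Bool) : sz b ≤ 3 := by cases b <;> simp [sz, enc, Data.ofBool, Data.size]

theorem sz_append {α : Type*} [Enc α] (l m : List α) : sz (l ++ m) + 1 = sz l + sz m := by
  induction l with
  | nil => simp only [List.nil_append, sz_nil]; omega
  | cons a l ih => simp only [List.cons_append, sz_cons]; omega

theorem sz_le_of_mem {α : Type*} [Enc α] {a : α} {l : List α} (h : a ∈ l) : sz a ≤ sz l := by
  induction l with
  | nil => simp at h
  | cons b l ih =>
    rw [sz_cons]
    rcases List.mem_cons.1 h with rfl | h
    · omega
    · have := ih h; omega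

theorem length_le_sz {α : Type*} [Enc α] (l : List α) : l.length ≤ sz l := by
  induction l with
  | nil => simp
  | cons a l ih => simp only [List.length_cons, sz_cons]; omega

theorem sz_le_of_forall {α : Type*} [Enc α] {l : List α} {b : ℕ} (h : ∀ a ∈ l, sz a ≤ b) :
    sz l ≤ 1 + l.length * (1 + b) := by
  induction l with
  | nil => simp [sz_nil]
  | cons a l ih =>
    have h1 := h a (by simp)
    have h2 := ih fun x hx => h x (by simp [hx])
    rw [sz_cons, List.length_cons, Nat.succ_mul]
    omega

theorem sz_bits_le (l : List Bool) : sz l ≤ 1 + l.length * 4 :=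
  sz_le_of_forall fun b _ => sz_bool_le b

/-- `f` is bounded by a polynomial in the size of the encoding of its argument. -/
def PolySize {α : Type*} [Enc α] (f : α → ℕ) : Prop :=
  ∃ q : Polynomial ℕ, ∀ a, f a ≤ q.eval (sz a)

/-- `f` is computed by a program in polynomial time. -/
def PolyTime {α β : Type*} [Enc α] [Enc β] (f : α → β) : Prop :=
  Computes (fun a : α => enc a) (fun a => enc (f a))

section PolyTime

variable {α β γ σ : Type*} [Enc α] [Enc β] [Enc γ] [Enc σ]

namespace PolySize

theorem of_le {f g : α → ℕ} (hg : PolySize g) (h : ∀ a, f a ≤ g a) : PolySize f := by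
  obtain ⟨q, hq⟩ := hg
  exact ⟨q, fun a => (h a).trans (hq a)⟩

theorem sz : PolySize (fun a : α => sz a) := ⟨Polynomial.X, fun a => by simp⟩

theorem const (m : ℕ) : PolySize (fun _ : α => m) := ⟨Polynomial.C m, fun a => by simp⟩

theorem add {f g : α → ℕ} (hf : PolySize f) (hg : PolySize g) : PolySize fun a => f a + g a := by
  obtain ⟨p, hp⟩ := hf
  obtain ⟨q, hq⟩ := hg
  exact ⟨p + q, fun a => by rw [Polynomial.eval_add]; exact add_le_add (hp a) (hq a)⟩

theorem mul {f g : α → ℕ} (hf : PolySize f) (hg : PolySize g) : PolySize fun a => f a * g a := by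
  obtain ⟨p, hp⟩ := hf
  obtain ⟨q, hq⟩ := hg
  exact ⟨p * q, fun a => by rw [Polynomial.eval_mul]; exact Nat.mul_le_mul (hp a) (hq a)⟩

theorem eval {f : α → ℕ} (q : Polynomial ℕ) (hf : PolySize f) :
    PolySize fun a => q.eval (f a) := by
  obtain ⟨p, hp⟩ := hf
  exact ⟨q.comp p, fun a => by rw [Polynomial.eval_comp]; exact eval_le_eval q (hp a)⟩

end PolySize

theorem PolyTime.exists_sz_le {f : α → β} (hf : PolyTime f) :
    ∃ q : Polynomial ℕ, ∀ a, sz (f a) ≤ q.eval (sz a) := by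
  obtain ⟨P, q, h⟩ := hf
  refine ⟨3 * q, fun a => ?_⟩
  obtain ⟨c, hc, hr⟩ := h a
  rw [Polynomial.eval_mul, Polynomial.eval_ofNat]
  exact hr.size_le.trans (Nat.mul_le_mul_left 3 hc)

theorem PolyTime.polySize {f : α → β} (hf : PolyTime f) : PolySize fun a => sz (f a) :=
  hf.exists_sz_le

theorem PolyTime.length_polySize {f : α → List β} (hf : PolyTime f) :
    PolySize fun a => (f a).length :=
  hf.polySize.of_le fun _ => length_le_sz _

/-- If each step adds at most `b` to the size of the state, as long as the state has an invariant
property, then folding over `l` adds at most `l.length * b`. -/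
theorem sz_foldl_le {α : Type*} {l : List α} {f : σ → α → σ} {b : ℕ} (I : σ → Prop)
    (h : ∀ s a, I s → a ∈ l → I (f s a) ∧ sz (f s a) ≤ sz s + b) {s : σ} (hs : I s) :
    sz (l.foldl f s) ≤ sz s + l.length * b := by
  induction l generalizing s with
  | nil => simp
  | cons a l ih =>
    obtain ⟨h1, h2⟩ := h s a hs (by simp)
    have h3 := ih (fun s b hs hb => h s b hs (by simp [hb])) h1
    rw [List.foldl_cons, List.length_cons, Nat.succ_mul]
    omega

namespace PolyTime

theorem id : PolyTime (fun a : α => a) := Computes.id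

theorem const (b : β) : PolyTime (fun _ : α => b) := Computes.const _

theorem comp {g : β → γ} {f : α → β} (hg : PolyTime g) (hf : PolyTime f) :
    PolyTime fun a => g (f a) := by
  obtain ⟨P, p, h⟩ := hg
  exact Computes.comp hf ⟨P, p, fun a => h (f a)⟩

theorem pair {f : α → β} {g : α → γ} (hf : PolyTime f) (hg : PolyTime g) :
    PolyTime fun a => (f a, g a) := Computes.pair hf hg

theorem fst {f : α → β × γ} (hf : PolyTime f) : PolyTime fun a => (f a).1 := Computes.fst hf

theorem snd {f : α → β × γ} (hf : PolyTime f) : PolyTime fun a => (f a).2 := Computes.snd hf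

theorem ite {b : α → Bool} {f g : α → β} (hb : PolyTime b) (hf : PolyTime f) (hg : PolyTime g) :
    PolyTime fun a => if b a then f a else g a := by
  refine (Computes.cond hb hf hg).congr fun a => ?_
  cases h : b a <;> simp [Enc.enc, Data.ofBool, h]

theorem decide_eq [DecidableEq β] {f g : α → β} (hf : PolyTime f) (hg : PolyTime g) :
    PolyTime fun a => decide (f a = g a) := by
  refine (Computes.eq hf hg).congr fun a => ?_
  rw [show enc (decide (f a = g a)) = Data.ofBool (decide (f a = g a)) from rfl]
  congr 1
  exact decide_eq_decide.2 Enc.inj.eq_iff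

theorem not {f : α → Bool} (hf : PolyTime f) : PolyTime fun a => !f a := by
  convert hf.ite (const false) (const true) using 2 with a
  cases f a <;> rfl

theorem and {f g : α → Bool} (hf : PolyTime f) (hg : PolyTime g) :
    PolyTime fun a => f a && g a := by
  convert hf.ite hg (const false) using 2 with a
  cases f a <;> rfl

theorem or {f g : α → Bool} (hf : PolyTime f) (hg : PolyTime g) :
    PolyTime fun a => f a || g a := by
  convert hf.ite (const true) hg using 2 with a
  cases f a <;> rfl

theorem cons {f : α → β} {g : α → List β} (hf : PolyTime f) (hg : PolyTime g) :
    PolyTime fun a => f a :: g a := Computes.pair hf hg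

theorem tail {f : α → List β} (hf : PolyTime f) : PolyTime fun a => (f a).tail := by
  refine (Computes.snd hf).congr fun a => ?_
  simp only
  cases f a <;> rfl

theorem isEmpty {f : α → List β} (hf : PolyTime f) : PolyTime fun a => (f a).isEmpty := by
  classical
  refine (Computes.eq hf (Computes.const (enc ([] : List β)))).congr fun a => ?_
  simp only
  cases f a <;> simp [Enc.enc, Data.ofList]

/-- Folding over a list takes polynomial time if all intermediate states have polynomial size. -/
theorem foldl_of_prefix {l : γ → List α} {s : γ → σ} {f : γ → σ → α → σ} {B : γ → ℕ}
    (hl : PolyTime l) (hs : PolyTime s) (hf : PolyTime fun x : γ × σ × α => f x.1 x.2.1 x.2.2)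
    (hB : PolySize B) (h : ∀ c l', l' <+: l c → sz (l'.foldl (f c) (s c)) ≤ B c) :
    PolyTime fun c => (l c).foldl (f c) (s c) := by
  -- The loop works on the rest of the list, the current state and the fixed argument `c`.
  let S : (List α × σ) × γ → Data := fun x => enc x
  have hinit : Computes (fun c : γ => enc c) (fun c => S ((l c, s c), c)) :=
    (Computes.pair (Computes.pair hl hs) Computes.id)
  have hbody : Computes (fun i : (α × List α × σ) × γ => S ((i.1.1 :: i.1.2.1, i.1.2.2), i.2))
      (fun i => S ((i.1.2.1, f i.2 i.1.2.2 i.1.1), i.2)) := by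
    have hid := Computes.id (x := fun i : (α × List α × σ) × γ =>
      S ((i.1.1 :: i.1.2.1, i.1.2.2), i.2))
    obtain ⟨P, p, hP⟩ := hf
    have harg := hid.snd.pair (hid.fst.snd.pair hid.fst.fst.fst)
    have hstep := harg.comp
      (z := fun i : (α × List α × σ) × γ => enc (f i.2 i.1.2.2 i.1.1))
      ⟨P, p, fun i => hP (i.2, i.1.2.2, i.1.1)⟩
    exact (hid.fst.fst.snd.pair hstep).pair hid.snd
  have htest : Computes S (fun x => enc x.1.1) := Computes.id.fst.fst
  obtain ⟨T, qt, hT⟩ := htest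
  obtain ⟨P, qb, hP⟩ := hbody
  obtain ⟨q, hq⟩ := hB
  obtain ⟨ql, hql⟩ := hl.exists_sz_le
  have hloop : ∃ (R : Prog) (r : Polynomial ℕ), ∀ c : γ, ∃ d ≤ r.eval (S ((l c, s c), c)).size,
      R.Runs (S ((l c, s c), c)) (S (([], (l c).foldl (f c) (s c)), c)) d := by
    -- `M` bounds the sizes of all trees on which the test and the body are run.
    have key (c : γ) (M : ℕ) (hM : sz (l c) + B c + sz c + 2 ≤ M) : ∀ l₂ l₁, l₁ ++ l₂ = l c →
        ∃ d ≤ (l₂.length + 1) * (M + qt.eval M + qb.eval M),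
          (Prog.loop T P).Runs (S ((l₂, l₁.foldl (f c) (s c)), c))
            (S (([], (l c).foldl (f c) (s c)), c)) d := by
      intro l₂
      induction l₂ with
      | nil =>
        intro l₁ h₁
        obtain rfl : l₁ = l c := by simpa using h₁
        obtain ⟨d, hd, hr⟩ := hT (([], (l c).foldl (f c) (s c)), c)
        refine ⟨_, ?_, Prog.Runs.loop_stop hr⟩
        have h2 := h c (l c) (List.prefix_refl _)
        have h3 : (S (([], (l c).foldl (f c) (s c)), c)).size ≤ M := by
          change sz ((([] : List α), (l c).foldl (f c) (s c)), c) ≤ M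
          rw [sz_prod, sz_prod, sz_nil]
          have := one_le_sz (l c)
          omega
        have h4 := eval_le_eval qt h3
        simp only [List.length_nil]
        omega
      | cons a l₂ ih =>
        intro l₁ h₁
        obtain ⟨d, hd, hr⟩ := hT ((a :: l₂, l₁.foldl (f c) (s c)), c)
        obtain ⟨e, he, hs⟩ := hP ((a, l₂, l₁.foldl (f c) (s c)), c)
        obtain ⟨g, hg, hu⟩ := ih (l₁ ++ [a]) (by simpa using h₁)
        have h3 : (S ((a :: l₂, l₁.foldl (f c) (s c)), c)).size ≤ M := by
          change sz ((a :: l₂, l₁.foldl (f c) (s c)), c) ≤ M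
          rw [sz_prod, sz_prod]
          have h2 := h c l₁ ⟨_, h₁⟩
          have h5 := sz_append l₁ (a :: l₂)
          rw [h₁] at h5
          have := one_le_sz l₁
          omega
        rw [List.foldl_append] at hu
        refine ⟨_, ?_, Prog.Runs.loop_step hr (by simp [enc_cons]) hs hu⟩
        have h4 := eval_le_eval qt h3
        have h5 := eval_le_eval qb h3
        simp only at he
        rw [List.length_cons, Nat.succ_mul]
        omega
    refine ⟨Prog.loop T P, (Polynomial.X + 1) *
      ((Polynomial.X + q + 2) + qt.comp (Polynomial.X + q + 2) + qb.comp (Polynomial.X + q + 2)),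
      fun c => ?_⟩
    have hsz : (S ((l c, s c), c)).size = 1 + (1 + sz (l c) + sz (s c)) + sz c := rfl
    set N := (S ((l c, s c), c)).size with hN
    have h1 : B c ≤ q.eval N := (hq c).trans (eval_le_eval q (by omega))
    obtain ⟨d, hd, hr⟩ := key c (N + q.eval N + 2) (by omega) (l c) [] rfl
    refine ⟨d, hd.trans ?_, hr⟩
    simp only [Polynomial.eval_mul, Polynomial.eval_add, Polynomial.eval_X, Polynomial.eval_one,
      Polynomial.eval_comp, Polynomial.eval_ofNat]
    refine Nat.mul_le_mul_right _ ?_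
    have := length_le_sz (l c)
    omega
  exact (hinit.comp hloop).fst.snd

/-- Folding over a list takes polynomial time if each step adds a polynomial amount to the size of
the state; the bound has to hold only for states with an invariant property. -/
theorem foldl {l : γ → List α} {s : γ → σ} {f : γ → σ → α → σ} {B : γ → ℕ}
    (hl : PolyTime l) (hs : PolyTime s) (hf : PolyTime fun x : γ × σ × α => f x.1 x.2.1 x.2.2)
    (hB : PolySize B) (I : γ → σ → Prop) (h₀ : ∀ c, I c (s c))
    (h : ∀ c t a, I c t → a ∈ l c → I c (f c t a) ∧ sz (f c t a) ≤ sz t + B c) :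
    PolyTime fun c => (l c).foldl (f c) (s c) := by
  refine foldl_of_prefix hl hs hf (hs.polySize.add (hl.length_polySize.mul hB)) fun c l' hl' => ?_
  refine (sz_foldl_le (I c) (fun t a ht ha => h c t a ht (hl'.subset ha)) (h₀ c)).trans ?_
  have := Nat.mul_le_mul_right (B c) hl'.length_le
  omega

theorem reverse {f : γ → List α} (hf : PolyTime f) : PolyTime fun c => (f c).reverse := by
  have := foldl (f := fun _ (s : List α) a => a :: s) hf (const []) (id.snd.snd.cons id.snd.fst)
    ((PolySize.const 1).add hf.polySize) (fun _ _ => True) (fun _ => trivial)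
    (fun c t a _ ha => ⟨trivial, by have := sz_le_of_mem ha; rw [sz_cons]; omega⟩)
  convert this using 2 with c
  simp

theorem append {f g : γ → List α} (hf : PolyTime f) (hg : PolyTime g) :
    PolyTime fun c => f c ++ g c := by
  have := foldl (f := fun _ (s : List α) a => a :: s) hf.reverse hg (id.snd.snd.cons id.snd.fst)
    ((PolySize.const 1).add hf.reverse.polySize) (fun _ _ => True) (fun _ => trivial)
    (fun c t a _ ha => ⟨trivial, by have := sz_le_of_mem ha; rw [sz_cons]; omega⟩)
  convert this using 2 with c
  simp

theorem map {l : γ → List α} {f : γ → α → β} (hl : PolyTime l)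
    (hf : PolyTime fun x : γ × α => f x.1 x.2) : PolyTime fun c => (l c).map (f c) := by
  obtain ⟨q, hq⟩ := hf.exists_sz_le
  have := foldl (f := fun c (s : List β) a => f c a :: s) (s := fun _ => []) hl (const [])
    ((hf.comp (id.fst.pair id.snd.snd)).cons id.snd.fst)
    ((PolySize.const 1).add
      (PolySize.eval q ((PolySize.const 1).add (PolySize.sz.add hl.polySize))))
    (fun _ _ => True) (fun _ => trivial)
    (fun c t a _ ha => ⟨trivial, by
      have h1 := hq (c, a)
      have h2 := eval_le_eval q (a := sz (c, a)) (b := 1 + (sz c + sz (l c)))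
        (by have := sz_le_of_mem ha; rw [sz_prod]; omega)
      simp only at h1
      rw [sz_cons]; omega⟩)
  convert this.reverse using 2 with c
  have (m : List α) (s : List β) :
      m.foldl (fun s a => f c a :: s) s = (m.map (f c)).reverse ++ s := by
    induction m generalizing s with
    | nil => rfl
    | cons a m ih => rw [List.foldl_cons, ih]; simp
  simp [this]

theorem any {l : γ → List α} {f : γ → α → Bool} (hl : PolyTime l)
    (hf : PolyTime fun x : γ × α => f x.1 x.2) : PolyTime fun c => (l c).any (f c) := by
  have := foldl (f := fun c (s : Bool) a => s || f c a) (s := fun _ => false) hl (const false)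
    (id.snd.fst.or (hf.comp (id.fst.pair id.snd.snd))) (PolySize.const 3)
    (fun _ _ => True) (fun _ => trivial)
    (fun c t a _ _ => ⟨trivial, (sz_bool_le _).trans (by omega)⟩)
  convert this using 2 with c
  have (m : List α) (s : Bool) : m.foldl (fun s a => s || f c a) s = (s || m.any (f c)) := by
    induction m generalizing s with
    | nil => simp
    | cons a m ih => rw [List.foldl_cons, ih]; simp [Bool.or_assoc]
  simp [this]

theorem all {l : γ → List α} {f : γ → α → Bool} (hl : PolyTime l)
    (hf : PolyTime fun x : γ × α => f x.1 x.2) : PolyTime fun c => (l c).all (f c) := by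
  convert (hl.any (f := fun c a => !f c a) hf.not).not using 2 with c
  simp [List.not_any_eq_all_not]

theorem length_lt {f : γ → List α} {g : γ → List β} (hf : PolyTime f) (hg : PolyTime g) :
    PolyTime fun c => decide ((f c).length < (g c).length) := by
  have h := foldl (f := fun _ (s : List β) _ => s.tail) hf hg id.snd.fst.tail (PolySize.const 0)
    (fun _ _ => True) (fun _ => trivial)
    (fun c t a _ _ => ⟨trivial, by
      cases t with
      | nil => simp
      | cons b t => rw [List.tail_cons, sz_cons]; omega⟩)
  convert h.isEmpty.not using 2 with c
  have (m : List α) (s : List β) : m.foldl (fun s _ => s.tail) s = s.drop m.length := by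
    induction m generalizing s with
    | nil => rfl
    | cons a m ih => rw [List.foldl_cons, ih]; simp
  rw [this, Bool.eq_iff_iff]
  simp

end PolyTime

/-! ### Binary numbers and indexing -/

/-- Addition of one to a number in binary, least significant bit first. -/
def succBits : List Bool → List Bool
  | [] => [true]
  | false :: l => true :: l
  | true :: l => false :: succBits l

theorem bits_succ (m : ℕ) : (m + 1).bits = succBits m.bits := by
  induction m using Nat.binaryRec' with
  | zero => simp [succBits]
  | bit c m hm ih =>
    rw [Nat.bits_append_bit m c hm]
    cases c with
    | false =>
      rw [succBits, ← Nat.bits_append_bit m true (by simp)]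
      simp [Nat.bit]
    | true =>
      have : Nat.bit true m + 1 = Nat.bit false (m + 1) := by simp [Nat.bit]; omega
      rw [succBits, this, Nat.bits_append_bit _ false (by simp), ih]

theorem sz_nat_succ (m : ℕ) : sz (m + 1) ≤ sz m + 4 := by
  change sz (m + 1).bits ≤ sz m.bits + 4
  rw [bits_succ]
  induction m.bits with
  | nil => decide
  | cons b l ih =>
    have h1 : sz true = 3 := rfl
    have h2 : sz false = 1 := rfl
    cases b <;> simp only [succBits, sz_cons] <;> omega

theorem sz_nat_le (m : ℕ) : sz m ≤ 1 + 4 * m := by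
  induction m with
  | zero => decide
  | succ m ih => have := sz_nat_succ m; omega

namespace PolyTime

theorem succ {f : γ → ℕ} (hf : PolyTime f) : PolyTime fun c => f c + 1 := by
  have hb : PolyTime fun c => (f c).bits := hf
  have h := foldl (f := fun _ (s : Bool × List Bool) b =>
      if s.1 then (b, (!b) :: s.2) else (false, b :: s.2)) (s := fun _ => (true, [])) hb (const _)
    (ite id.snd.fst.fst (id.snd.snd.pair (id.snd.snd.not.cons id.snd.fst.snd))
      ((const false).pair (id.snd.snd.cons id.snd.fst.snd))) (PolySize.const 8)
    (fun _ _ => True) (fun _ => trivial)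
    (fun c t a _ _ => ⟨trivial, by
      obtain ⟨b, l⟩ := t
      have := sz_bool_le a
      have := sz_bool_le (!a)
      have := sz_bool_le false
      cases b <;> simp [sz_prod, sz_cons] <;> omega⟩)
  have key : PolyTime fun c => succBits (f c).bits := by
    convert (ite h.fst (h.snd.reverse.append (const [true])) h.snd.reverse) using 2 with c
    have h1 (m o : List Bool) : m.foldl (fun (s : Bool × List Bool) b =>
        if s.1 then (b, (!b) :: s.2) else (false, b :: s.2)) (false, o) =
          (false, m.reverse ++ o) := by
      induction m generalizing o with
      | nil => rfl
      | cons b m ih => rw [List.foldl_cons]; simp only [Bool.false_eq_true, if_false]; rw [ih]; simp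
    have h2 (m o : List Bool) : o.reverse ++ succBits m =
        (fun s : Bool × List Bool => if s.1 then s.2.reverse ++ [true] else s.2.reverse)
        (m.foldl (fun (s : Bool × List Bool) b =>
        if s.1 then (b, (!b) :: s.2) else (false, b :: s.2)) (true, o)) := by
      induction m generalizing o with
      | nil => simp [succBits]
      | cons b m ih =>
        rw [List.foldl_cons]
        cases b with
        | false => simp only [if_true]; rw [h1]; simp [succBits]
        | true =>
          have := ih (false :: o)
          simp only [if_true, Bool.not_true] at this ⊢
          rw [← this]
          simp [succBits]
    simpa using h2 (f c).bits []
  simp only [← bits_succ] at key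
  exact key

theorem range_length {l : γ → List α} (hl : PolyTime l) :
    PolyTime fun c => List.range (l c).length := by
  have key (m : List α) : m.foldl (fun (s : ℕ × List ℕ) _ => (s.1 + 1, s.2 ++ [s.1])) (0, []) =
      (m.length, List.range m.length) := by
    induction m using List.reverseRecOn with
    | nil => rfl
    | append_singleton m a ih => rw [List.foldl_append, ih]; simp [List.range_succ]
  have h := foldl_of_prefix (f := fun _ (s : ℕ × List ℕ) _ => (s.1 + 1, s.2 ++ [s.1]))
    (s := fun _ => (0, [])) (B := fun c => 1 + (1 + 4 * (l c).length) +
      (1 + (l c).length * (1 + (1 + 4 * (l c).length)))) hl (const _)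
    (id.snd.fst.fst.succ.pair (id.snd.fst.snd.append (id.snd.fst.fst.cons (const []))))
    (by
      have := hl.length_polySize
      have h4 := (PolySize.const 1).add ((PolySize.const 4).mul this)
      exact ((PolySize.const 1).add h4).add
        ((PolySize.const 1).add (this.mul ((PolySize.const 1).add h4))))
    (fun c l' hl' => by
      have hle := hl'.length_le
      rw [key, sz_prod]
      have h1 := sz_nat_le l'.length
      have h2 := sz_le_of_forall (l := List.range l'.length) (b := 1 + 4 * (l c).length)
        (fun a ha => (sz_nat_le a).trans (by have := List.mem_range.1 ha; omega))
      rw [List.length_range] at h2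
      have h3 := Nat.mul_le_mul_right (1 + (1 + 4 * (l c).length)) hle
      omega)
  convert h.snd using 2 with c
  rw [key]

theorem getD {l : γ → List α} {i : γ → ℕ} {d : γ → α} (hl : PolyTime l) (hi : PolyTime i)
    (hd : PolyTime d) : PolyTime fun c => (l c).getD (i c) (d c) := by
  have key (m : List α) (j : ℕ) (d : α) :
      m.foldl (fun (s : ℕ × α) a => (s.1 + 1, if decide (s.1 = j) then a else s.2)) (0, d) =
        (m.length, m.getD j d) := by
    induction m using List.reverseRecOn with
    | nil => rfl
    | append_singleton m a ih =>
      rw [List.foldl_append, ih]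
      simp only [List.foldl_cons, List.foldl_nil, decide_eq_true_eq, List.length_append,
        List.length_singleton, Prod.mk.injEq, true_and]
      split_ifs with h
      · subst h; simp
      · rcases lt_or_gt_of_ne h with h | h
        · rw [List.getD_eq_default _ _ (by omega), List.getD_eq_default]
          simp; omega
        · rw [List.getD_append _ _ _ _ h]
  have h := foldl (f := fun c (s : ℕ × α) a => (s.1 + 1, if decide (s.1 = i c) then a else s.2))
    (s := fun c => (0, d c)) hl ((const 0).pair hd)
    (id.snd.fst.fst.succ.pair (ite (decide_eq id.snd.fst.fst (hi.comp id.fst)) id.snd.snd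
      id.snd.fst.snd)) ((PolySize.const 4).add hl.polySize) (fun _ _ => True) (fun _ => trivial)
    (fun c t a _ ha => ⟨trivial, by
      obtain ⟨m, b⟩ := t
      have h1 := sz_le_of_mem ha
      have h2 := sz_nat_succ m
      simp only [sz_prod]
      split_ifs <;> omega⟩)
  convert h.snd using 2 with c
  rw [key]

end PolyTime

end PolyTime

/-! ### The algorithm -/

/-- A coloured graph on the vertices `0, …, n - 1`: the rows of its adjacency matrix and the list
of the colours of the vertices. Vertex sets are represented by bit vectors. -/
abbrev Instance := List (List Bool) × List ℕ

namespace Instance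

/-- The list of the vertices. -/
def verts (I : Instance) : List ℕ := List.range I.2.length

/-- Membership in a set given as a bit vector. -/
def mem (W : List Bool) (v : ℕ) : Bool := W.getD v false

/-- Adjacency of two vertices. -/
def adj (I : Instance) (u v : ℕ) : Bool := mem (I.1.getD u []) v

/-- The colour of a vertex. -/
def col (I : Instance) (v : ℕ) : ℕ := I.2.getD v 0

/-- The table of the values of `f` at the vertices. -/
def tab {α : Type*} (I : Instance) (f : ℕ → α) : List α := I.verts.map f

/-- Adds to `R` the elements of `S` with a neighbour in `R`. -/
def grow (I : Instance) (S R : List Bool) : List Bool :=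
  I.tab fun u => mem R u || (mem S u && I.verts.any fun w => mem R w && I.adj w u)

/-- The vertices that can be reached from `v` by a path whose vertices other than `v` are in
`S`. -/
def component (I : Instance) (S : List Bool) (v : ℕ) : List Bool :=
  I.verts.foldl (fun R _ => I.grow S R) (I.tab fun u => decide (u = v))

/-- The component of `v` in the graph induced by `W` and the colour class of `v`. -/
def area (I : Instance) (W : List Bool) (v : ℕ) : List Bool :=
  I.component (I.tab fun u => mem W u || decide (I.col u = I.col v)) v

/-- The set of finished vertices after the stroke with pivot `v`, when `W` is the set of the
vertices that later strokes repaint. -/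
def advance (I : Instance) (W : List Bool) (v : ℕ) : List Bool :=
  I.tab fun u => mem W u || mem (I.area W v) u

/-- The finished vertices after the strokes with the pivots in `Q`. -/
def finished (I : Instance) (Q : List ℕ) : List Bool :=
  Q.foldl I.advance (I.tab fun _ => false)

/-- The vertex `v` of `T` is not in `W`, and the stroke with pivot `v` finishes all vertices of `T`
that have the colour of `v`. -/
def completes (I : Instance) (T W : List Bool) (v : ℕ) : Bool :=
  mem T v && (!mem W v && I.verts.all fun u =>
    (!(mem T u && decide (I.col u = I.col v))) || mem (I.advance W v) u)

/-- Appends `v` to the pivots if this completes a colour. -/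
def closeAt (I : Instance) (T : List Bool) (Q : List ℕ) (v : ℕ) : List ℕ :=
  if I.completes T (I.finished Q) v then Q ++ [v] else Q

/-- Appends pivots that complete colours of vertices of `T`, as long as there are any. -/
def close (I : Instance) (T : List Bool) (Q : List ℕ) : List ℕ :=
  I.verts.foldl (fun Q _ => I.verts.foldl (I.closeAt T) Q) Q

/-- All vertices in `T` are finished after the strokes with the pivots in `Q`. -/
def covers (I : Instance) (T : List Bool) (Q : List ℕ) : Bool :=
  I.verts.all fun u => (!mem T u) || mem (I.finished Q) u

/-- `Q` is preferable to `R`: it covers `T`, and `R` does not or is longer. -/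
def better (I : Instance) (T : List Bool) (Q R : List ℕ) : Bool :=
  I.covers T Q && ((!I.covers T R) || decide (Q.length < R.length))

end Instance

/-- An element of `s :: l` to which no other one is preferable, if `r` compares costs. -/
def select {σ : Type*} (r : σ → σ → Bool) (s : σ) (l : List σ) : σ :=
  l.foldl (fun b a => if r a b then a else b) s

namespace Instance

/-- Extends `Q` by pivots that complete colours of `T` and at most `d` further pivots, for which all
choices are tried; among the resulting sequences that cover `T`, a shortest one is taken. -/
def best (I : Instance) (T : List Bool) : ℕ → List ℕ → List ℕ
  | 0, Q => I.close T Q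
  | d + 1, Q => select (I.better T) (I.close T Q)
      (I.verts.map fun v => I.best T d (I.close T Q ++ [v]))

/-- The elements of `T` in the connected component of `v`. -/
def target (I : Instance) (T : List Bool) (v : ℕ) : List Bool :=
  I.tab fun u => mem T u && mem (I.component (I.tab fun _ => true) v) u

/-- A shortest sequence of pivots that covers `T`. -/
def cover (I : Instance) (T : List Bool) : List ℕ :=
  I.verts.foldl (fun Q v =>
    if I.covers (I.target T v) Q then Q else I.best (I.target T v) 4 Q) []

/-- The strokes with the pivots in `Q`, in the order of painting: the stroke with the first pivot
is the last one. -/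
def strokes (I : Instance) (Q : List ℕ) : List (List Bool × ℕ) :=
  (Q.foldl (fun s v => (I.advance s.1 v, (I.area s.1 v, I.col v) :: s.2))
    (I.tab fun _ => false, ([] : List (List Bool × ℕ)))).2

/-- An optimal paint plan. Since paint plans are not empty, the graph without vertices needs a
stroke, too. -/
def plan (I : Instance) : List (List Bool × ℕ) :=
  if (I.cover (I.tab fun _ => true)).isEmpty then [([], 0)]
  else I.strokes (I.cover (I.tab fun _ => true))

/-- A shortest sequence of pivots that covers all vertices except those of one colour. -/
def floodCover (I : Instance) : List ℕ :=
  select (fun Q R => decide (Q.length < R.length)) (I.cover (I.tab fun _ => true))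
    (I.verts.map fun v => I.cover (I.tab fun u => !decide (I.col u = I.col v)))

/-- The coloured graph after the move with pivot `v` and colour `c`. -/
def flood (I : Instance) (v c : ℕ) : Instance :=
  (I.1, I.tab fun w =>
    if mem (I.component (I.tab fun u => decide (I.col u = I.col v)) v) w then c else I.col w)

/-- Makes a move that minimizes the length of the remaining flooding sequence, and appends it to the
list of moves; makes no move if this does not shorten the remaining sequence. -/
def floodStep (s : Instance × List (ℕ × ℕ)) : Instance × List (ℕ × ℕ) :=
  select (fun a b => decide (a.1.floodCover.length < b.1.floodCover.length)) s
    ((s.1.verts.flatMap fun v => s.1.verts.map fun u => (v, s.1.col u)).map fun m =>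
      (s.1.flood m.1 m.2, s.2 ++ [m]))

/-- An optimal flooding sequence. -/
def moves (I : Instance) : List (ℕ × ℕ) :=
  (I.floodCover.foldl (fun s _ => floodStep s) (I, [])).2

/-! ### The running time of the algorithm -/

theorem length_tab {α : Type*} (I : Instance) (f : ℕ → α) : (I.tab f).length = I.2.length := by
  simp [tab, verts]

theorem length_verts (I : Instance) : I.verts.length = I.2.length := by
  simp [verts]

theorem length_colors_le (I : Instance) : I.2.length ≤ sz I := by
  have := length_le_sz I.2
  have : sz I = 1 + sz I.1 + sz I.2 := rfl
  omega

theorem sz_tab_le (I : Instance) (f : ℕ → Bool) : sz (I.tab f) ≤ 1 + sz I * 4 := by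
  refine (sz_bits_le _).trans ?_
  have := I.length_colors_le
  rw [length_tab]
  omega

theorem sz_component_le (I : Instance) (S : List Bool) (v : ℕ) :
    sz (I.component S v) ≤ 1 + sz I * 4 := by
  unfold component
  induction I.verts using List.reverseRecOn with
  | nil => exact I.sz_tab_le _
  | append_singleton l a _ => rw [List.foldl_append]; exact I.sz_tab_le _

theorem sz_col_le (I : Instance) (v : ℕ) : sz (I.col v) ≤ sz I := by
  unfold col
  rw [List.getD_eq_getElem?_getD]
  rcases h : I.2[v]? with _ | x
  · exact one_le_sz I
  · have h1 := sz_le_of_mem (List.mem_of_getElem? h)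
    have : sz I = 1 + sz I.1 + sz I.2 := rfl
    simp only [Option.getD_some]
    omega

end Instance

theorem select_mem {σ : Type*} (r : σ → σ → Bool) (s : σ) (l : List σ) : select r s l ∈ s :: l := by
  unfold select
  induction l generalizing s with
  | nil => simp
  | cons a l ih =>
    rw [List.foldl_cons]
    have := ih (if r a s then a else s)
    rcases List.mem_cons.1 this with h | h
    · rw [h]; split_ifs <;> simp
    · simp [h]

section

open Instance

variable {α β γ σ : Type*} [Enc α] [Enc β] [Enc γ] [Enc σ]

namespace PolyTime

theorem flatMap {l : γ → List α} {f : γ → α → List β} (hl : PolyTime l)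
    (hf : PolyTime fun x : γ × α => f x.1 x.2) : PolyTime fun c => (l c).flatMap (f c) := by
  obtain ⟨q, hq⟩ := hf.exists_sz_le
  have := foldl (f := fun c (s : List β) a => s ++ f c a) (s := fun _ => []) hl (const [])
    (id.snd.fst.append (hf.comp (id.fst.pair id.snd.snd)))
    (PolySize.eval q ((PolySize.const 1).add (PolySize.sz.add hl.polySize)))
    (fun _ _ => True) (fun _ => trivial)
    (fun c t a _ ha => ⟨trivial, by
      have h1 := hq (c, a)
      have h2 := eval_le_eval q (a := sz (c, a)) (b := 1 + (sz c + sz (l c)))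
        (by have := sz_le_of_mem ha; rw [sz_prod]; omega)
      have h3 := sz_append t (f c a)
      simp only at h1
      omega⟩)
  convert this using 2 with c
  have (m : List α) (s : List β) : m.foldl (fun s a => s ++ f c a) s = s ++ m.flatMap (f c) := by
    induction m generalizing s with
    | nil => simp
    | cons a m ih => rw [List.foldl_cons, ih]; simp
  simp [this]

theorem select {r : γ → σ → σ → Bool} {s : γ → σ} {l : γ → List σ}
    (hr : PolyTime fun x : γ × σ × σ => r x.1 x.2.1 x.2.2) (hs : PolyTime s) (hl : PolyTime l) :
    PolyTime fun c => select (r c) (s c) (l c) := by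
  refine foldl_of_prefix (f := fun c b a => if r c a b then a else b) hl hs
    (ite (hr.comp (id.fst.pair (id.snd.snd.pair id.snd.fst))) id.snd.snd id.snd.fst)
    (hs.polySize.add hl.polySize) fun c l' hl' => ?_
  rcases List.mem_cons.1 (select_mem (r c) (s c) l') with h | h
  · unfold Painting.select at h
    rw [h]; omega
  · have := sz_le_of_mem (hl'.subset h)
    unfold Painting.select at this
    omega

variable {I : γ → Instance} {S T W R : γ → List Bool} {v u c : γ → ℕ} {Q : γ → List ℕ}

theorem verts (hI : PolyTime I) : PolyTime fun c => (I c).verts := range_length hI.snd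

theorem mem (hW : PolyTime W) (hv : PolyTime v) : PolyTime fun c => mem (W c) (v c) :=
  getD hW hv (const false)

theorem adj (hI : PolyTime I) (hu : PolyTime u) (hv : PolyTime v) :
    PolyTime fun c => (I c).adj (u c) (v c) :=
  mem (getD hI.fst hu (const [])) hv

theorem col (hI : PolyTime I) (hv : PolyTime v) : PolyTime fun c => (I c).col (v c) :=
  getD hI.snd hv (const 0)

theorem tab {f : γ → ℕ → α} (hI : PolyTime I) (hf : PolyTime fun x : γ × ℕ => f x.1 x.2) :
    PolyTime fun c => (I c).tab (f c) :=
  map hI.verts hf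

theorem grow (hI : PolyTime I) (hS : PolyTime S) (hR : PolyTime R) :
    PolyTime fun c => (I c).grow (S c) (R c) :=
  tab hI (or (mem (hR.comp id.fst) id.snd) (and (mem (hS.comp id.fst) id.snd)
    (any (verts (hI.comp id.fst)) (and (mem (hR.comp id.fst.fst) id.snd)
      (adj (hI.comp id.fst.fst) id.snd id.fst.snd)))))

theorem component (hI : PolyTime I) (hS : PolyTime S) (hv : PolyTime v) :
    PolyTime fun c => (I c).component (S c) (v c) :=
  foldl (f := fun c R _ => (I c).grow (S c) R) hI.verts
    (tab hI (decide_eq id.snd (hv.comp id.fst)))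
    (grow (hI.comp id.fst) (hS.comp id.fst) id.snd.fst)
    ((PolySize.const 1).add (hI.polySize.mul (PolySize.const 4)))
    (fun _ _ => True) (fun _ => trivial)
    (fun c _ _ _ _ => ⟨trivial, ((I c).sz_tab_le _).trans (by omega)⟩)

theorem area (hI : PolyTime I) (hW : PolyTime W) (hv : PolyTime v) :
    PolyTime fun c => (I c).area (W c) (v c) :=
  component hI (tab hI (or (mem (hW.comp id.fst) id.snd)
    (decide_eq (col (hI.comp id.fst) id.snd) (col (hI.comp id.fst) (hv.comp id.fst))))) hv

theorem advance (hI : PolyTime I) (hW : PolyTime W) (hv : PolyTime v) :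
    PolyTime fun c => (I c).advance (W c) (v c) :=
  tab hI (or (mem (hW.comp id.fst) id.snd) (mem ((area hI hW hv).comp id.fst) id.snd))

theorem finished (hI : PolyTime I) (hQ : PolyTime Q) :
    PolyTime fun c => (I c).finished (Q c) :=
  foldl (f := fun c W v => (I c).advance W v) hQ (tab (f := fun _ _ => false) hI (const false))
    (advance (hI.comp id.fst) id.snd.fst id.snd.snd)
    ((PolySize.const 1).add (hI.polySize.mul (PolySize.const 4)))
    (fun _ _ => True) (fun _ => trivial)
    (fun c _ _ _ _ => ⟨trivial, ((I c).sz_tab_le _).trans (by omega)⟩)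

theorem completes (hI : PolyTime I) (hT : PolyTime T) (hW : PolyTime W) (hv : PolyTime v) :
    PolyTime fun c => (I c).completes (T c) (W c) (v c) :=
  and (mem hT hv) (and (mem hW hv).not (all hI.verts
    (or (and (mem (hT.comp id.fst) id.snd) (decide_eq (col (hI.comp id.fst) id.snd)
        (col (hI.comp id.fst) (hv.comp id.fst)))).not
      (mem ((advance hI hW hv).comp id.fst) id.snd))))

theorem closeAt (hI : PolyTime I) (hT : PolyTime T) (hQ : PolyTime Q) (hv : PolyTime v) :
    PolyTime fun c => (I c).closeAt (T c) (Q c) (v c) :=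
  ite (completes hI hT (finished hI hQ) hv) (hQ.append (hv.cons (const []))) hQ

end PolyTime

namespace Instance

theorem sz_closeAt_le (I : Instance) (T : List Bool) (Q : List ℕ) {v : ℕ} (hv : v ∈ I.verts) :
    sz (I.closeAt T Q v) ≤ sz Q + (1 + sz I.verts) := by
  have h1 := sz_le_of_mem hv
  have h2 := sz_append Q [v]
  rw [sz_cons, sz_nil] at h2
  unfold closeAt
  split_ifs <;> omega

theorem sz_close_le (I : Instance) (T : List Bool) (Q : List ℕ) :
    sz (I.close T Q) ≤ sz Q + I.verts.length * (I.verts.length * (1 + sz I.verts)) :=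
  sz_foldl_le (fun _ => True) (fun _ _ _ _ => ⟨trivial, sz_foldl_le (fun _ => True)
    (fun Q _ _ hv => ⟨trivial, I.sz_closeAt_le T Q hv⟩) trivial⟩) trivial

/-- A bound for the size of what one round of the search appends to a list of pivots. -/
def growth (I : Instance) : ℕ :=
  I.verts.length * (I.verts.length * (1 + sz I.verts)) + (1 + sz I.verts)

theorem sz_best_le (I : Instance) (T : List Bool) (d : ℕ) (Q : List ℕ) :
    sz (I.best T d Q) ≤ sz Q + (d + 1) * I.growth := by
  induction d generalizing Q with
  | zero =>
    have := I.sz_close_le T Q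
    unfold best growth
    omega
  | succ d ih =>
    have h1 := I.sz_close_le T Q
    unfold best
    rw [Nat.succ_mul]
    rcases List.mem_cons.1 (select_mem (I.better T) (I.close T Q)
      (I.verts.map fun v => I.best T d (I.close T Q ++ [v]))) with h | h
    · rw [h]; unfold growth; omega
    · obtain ⟨v, hv, h⟩ := List.mem_map.1 h
      rw [← h]
      have h2 := ih (I.close T Q ++ [v])
      have h3 := sz_append (I.close T Q) [v]
      have h4 := sz_le_of_mem hv
      rw [sz_cons, sz_nil] at h3
      have h5 : I.growth =
        I.verts.length * (I.verts.length * (1 + sz I.verts)) + (1 + sz I.verts) := rfl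
      omega

end Instance

namespace PolyTime

variable {I : γ → Instance} {T : γ → List Bool} {v c : γ → ℕ} {Q R : γ → List ℕ}

theorem close (hI : PolyTime I) (hT : PolyTime T) (hQ : PolyTime Q) :
    PolyTime fun c => (I c).close (T c) (Q c) := by
  have hB : PolySize fun c => (I c).verts.length * (1 + sz (I c).verts) :=
    hI.verts.length_polySize.mul ((PolySize.const 1).add hI.verts.polySize)
  have h := foldl (f := fun (x : γ × List ℕ) Q v => (I x.1).closeAt (T x.1) Q v)
    (s := fun x : γ × List ℕ => x.2) (verts (hI.comp id.fst)) id.snd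
    (closeAt (hI.comp id.fst.fst) (hT.comp id.fst.fst) id.snd.fst id.snd.snd)
    ((PolySize.const 1).add (hI.comp id.fst).verts.polySize)
    (fun _ _ => True) (fun _ => trivial)
    (fun x Q v _ hv => ⟨trivial, (I x.1).sz_closeAt_le _ Q hv⟩)
  exact foldl (f := fun c Q _ => (I c).verts.foldl ((I c).closeAt (T c)) Q) hI.verts hQ
    (h.comp (id.fst.pair id.snd.fst)) hB (fun _ _ => True) (fun _ => trivial)
    (fun c Q v _ _ => ⟨trivial, sz_foldl_le (fun _ => True)
      (fun Q _ _ hv => ⟨trivial, (I c).sz_closeAt_le (T c) Q hv⟩) trivial⟩)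

theorem covers (hI : PolyTime I) (hT : PolyTime T) (hQ : PolyTime Q) :
    PolyTime fun c => (I c).covers (T c) (Q c) :=
  all hI.verts (or (mem (hT.comp id.fst) id.snd).not
    (mem ((finished hI hQ).comp id.fst) id.snd))

theorem better (hI : PolyTime I) (hT : PolyTime T) (hQ : PolyTime Q) (hR : PolyTime R) :
    PolyTime fun c => (I c).better (T c) (Q c) (R c) :=
  and (covers hI hT hQ) (or (covers hI hT hR).not (length_lt hQ hR))

theorem best (d : ℕ) (hI : PolyTime I) (hT : PolyTime T) (hQ : PolyTime Q) :
    PolyTime fun c => (I c).best (T c) d (Q c) := by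
  have key : PolyTime fun x : Instance × List Bool × List ℕ => x.1.best x.2.1 d x.2.2 := by
    induction d with
    | zero => exact close id.fst id.snd.fst id.snd.snd
    | succ d ih =>
      have hc := close (γ := Instance × List Bool × List ℕ) id.fst id.snd.fst id.snd.snd
      exact select (better id.fst.fst id.fst.snd.fst id.snd.fst id.snd.snd) hc
        (map id.fst.verts (ih.comp (id.fst.fst.pair (id.fst.snd.fst.pair
          ((hc.comp id.fst).append (id.snd.cons (const [])))))))
  exact key.comp (hI.pair (hT.pair hQ))

theorem target (hI : PolyTime I) (hT : PolyTime T) (hv : PolyTime v) :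
    PolyTime fun c => (I c).target (T c) (v c) := by
  have h := component hI (tab (f := fun _ _ => true) hI (const true)) hv
  exact tab hI (and (mem (hT.comp id.fst) id.snd) (mem (h.comp id.fst) id.snd))

theorem cover (hI : PolyTime I) (hT : PolyTime T) :
    PolyTime fun c => (I c).cover (T c) := by
  have hl := target (I := fun x : γ × List ℕ × ℕ => I x.1) (hI.comp id.fst) (hT.comp id.fst)
    id.snd.snd
  have hg : PolySize fun c => (I c).growth :=
    (hI.verts.length_polySize.mul (hI.verts.length_polySize.mul
      ((PolySize.const 1).add hI.verts.polySize))).add ((PolySize.const 1).add hI.verts.polySize)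
  refine foldl (s := fun _ => []) (f := fun c Q v =>
    if (I c).covers ((I c).target (T c) v) Q then Q else (I c).best ((I c).target (T c) v) 4 Q)
    hI.verts (const []) (ite (covers (hI.comp id.fst) hl id.snd.fst) id.snd.fst
      (best 4 (hI.comp id.fst) hl id.snd.fst)) ((PolySize.const 5).mul hg)
    (fun _ _ => True) (fun _ => trivial) fun c Q v _ _ => ⟨trivial, ?_⟩
  split_ifs
  · omega
  · exact (I c).sz_best_le _ 4 Q

theorem strokes (hI : PolyTime I) (hQ : PolyTime Q) :
    PolyTime fun c => (I c).strokes (Q c) := by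
  have hI' : PolyTime fun x : γ × (List Bool × List (List Bool × ℕ)) × ℕ => I x.1 :=
    hI.comp id.fst
  have h := area hI' id.snd.fst.fst id.snd.snd
  refine snd (foldl
    (f := fun c s v => ((I c).advance s.1 v, ((I c).area s.1 v, (I c).col v) :: s.2))
    (s := fun c => ((I c).tab fun _ => false, ([] : List (List Bool × ℕ))))
    (B := fun c => (1 + sz (I c) * 4) + (1 + ((1 + (1 + (1 + sz (I c) * 4))) + sz (I c)))) hQ
    ((tab (f := fun _ _ => false) hI (const false)).pair (const []))
    (pair (advance hI' id.snd.fst.fst id.snd.snd)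
      (cons (pair h (col hI' id.snd.snd)) id.snd.fst.snd)) ?_
    (fun _ _ => True) (fun _ => trivial) fun c s v _ _ => ⟨trivial, ?_⟩)
  · have h1 := (PolySize.const 1).add (hI.polySize.mul (PolySize.const 4))
    exact h1.add ((PolySize.const 1).add (((PolySize.const 1).add ((PolySize.const 1).add h1)).add
      hI.polySize))
  · have h1 := (I c).sz_tab_le fun u => Instance.mem s.1 u || Instance.mem ((I c).area s.1 v) u
    have h2 := (I c).sz_component_le
      ((I c).tab fun u => Instance.mem s.1 u || decide ((I c).col u = (I c).col v)) v
    have h3 := (I c).sz_col_le v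
    obtain ⟨W, o⟩ := s
    simp only [sz_prod, sz_cons] at h1 h2 h3 ⊢
    unfold Instance.advance Instance.area at *
    omega

theorem plan (hI : PolyTime I) : PolyTime fun c => (I c).plan := by
  have h := cover hI (tab (f := fun _ _ => true) hI (const true))
  exact ite h.isEmpty (const _) (strokes hI h)

theorem floodCover (hI : PolyTime I) : PolyTime fun c => (I c).floodCover :=
  select (length_lt id.snd.fst id.snd.snd) (cover hI (tab (f := fun _ _ => true) hI (const true)))
    (map hI.verts (cover (hI.comp id.fst) (tab (hI.comp id.fst)
      (decide_eq (col (hI.comp id.fst.fst) id.snd) (col (hI.comp id.fst.fst) id.fst.snd)).not)))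

theorem flood (hI : PolyTime I) (hv : PolyTime v) (hc : PolyTime c) :
    PolyTime fun x => (I x).flood (v x) (c x) := by
  have h := component hI (tab (f := fun x u => decide ((I x).col u = (I x).col (v x))) hI
    (decide_eq (col (hI.comp id.fst) id.snd) (col (hI.comp id.fst) (hv.comp id.fst)))) hv
  exact hI.fst.pair (tab hI (ite (mem (h.comp id.fst) id.snd) (hc.comp id.fst)
    (col (hI.comp id.fst) id.snd)))

theorem floodStep {s : γ → Instance × List (ℕ × ℕ)} (hs : PolyTime s) :
    PolyTime fun c => floodStep (s c) :=
  select (length_lt id.snd.fst.fst.floodCover id.snd.snd.fst.floodCover) hs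
    (map (flatMap hs.fst.verts (map (hs.fst.verts.comp id.fst)
        (id.fst.snd.pair (col (hs.fst.comp id.fst.fst) id.snd))))
      (pair (flood (hs.fst.comp id.fst) id.snd.fst id.snd.snd)
        ((hs.snd.comp id.fst).append (id.snd.cons (const [])))))

/-- The colours in the intermediate states are among the colours of the original instance, and
thus have bounded size. -/
theorem moves (hI : PolyTime I) : PolyTime fun c => (I c).moves := by
  refine snd (foldl (f := fun _ s _ => Instance.floodStep s) (s := fun c => (I c, []))
    (B := fun c => (1 + sz (I c) + (1 + sz (I c) * (1 + sz (I c)))) +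
      (2 + (1 + sz (I c).verts + sz (I c))))
    hI.floodCover (hI.pair (const [])) (floodStep id.snd.fst) ?_
    (fun c s => s.1.1 = (I c).1 ∧ s.1.2.length = (I c).2.length ∧ ∀ x ∈ s.1.2, sz x ≤ sz (I c))
    (fun c => ⟨rfl, rfl, fun x hx => (sz_le_of_mem (l := (I c).2) hx).trans (by
      have : sz (I c) = 1 + sz (I c).1 + sz (I c).2 := rfl
      omega)⟩) fun c s _ hs _ => ?_)
  · have h := hI.polySize
    have h1 := PolySize.const (α := γ) 1
    exact ((h1.add h).add (h1.add (h.mul (h1.add h)))).add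
      ((PolySize.const 2).add ((h1.add hI.verts.polySize).add h))
  · obtain ⟨J, o⟩ := s
    obtain ⟨h1, h2, h3⟩ := hs
    simp only at h1 h2 h3
    have hcol (u : ℕ) : sz (J.col u) ≤ sz (I c) := by
      unfold Instance.col
      rw [List.getD_eq_getElem?_getD]
      rcases h : J.2[u]? with _ | x
      · exact one_le_sz (I c)
      · exact h3 x (List.mem_of_getElem? h)
    have hverts : J.verts = (I c).verts := by unfold Instance.verts; rw [h2]
    have hmem := select_mem
      (fun a b : Instance × List (ℕ × ℕ) => decide (a.1.floodCover.length < b.1.floodCover.length))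
      (J, o) ((J.verts.flatMap fun v => J.verts.map fun u => (v, J.col u)).map fun m =>
        (J.flood m.1 m.2, o ++ [m]))
    rcases List.mem_cons.1 hmem with h | h
    · rw [show Instance.floodStep (J, o) = (J, o) from h]
      exact ⟨⟨h1, h2, h3⟩, by omega⟩
    · obtain ⟨m, hm, h⟩ := List.mem_map.1 h
      rw [show Instance.floodStep (J, o) = _ from h.symm]
      obtain ⟨v, hv, hm⟩ := List.mem_flatMap.1 hm
      obtain ⟨u, hu, rfl⟩ := List.mem_map.1 hm
      have hflood : ∀ x ∈ (J.flood v (J.col u)).2, sz x ≤ sz (I c) := by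
        intro x hx
        obtain ⟨w, hw, rfl⟩ := List.mem_map.1 hx
        split_ifs <;> exact hcol _
      have hlen : (J.flood v (J.col u)).2.length = (I c).2.length := by
        rw [← h2]; exact J.length_tab _
      refine ⟨⟨h1, hlen, hflood⟩, ?_⟩
      have h4 := sz_le_of_forall hflood
      have h5 : (J.flood v (J.col u)).2.length ≤ sz (I c) := hlen.trans_le (I c).length_colors_le
      have h6 := Nat.mul_le_mul_right (1 + sz (I c)) h5
      have h7 : sz (J.flood v (J.col u)) =
        1 + sz (J.flood v (J.col u)).1 + sz (J.flood v (J.col u)).2 := rfl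
      have h8 : sz (J.flood v (J.col u)).1 ≤ sz (I c) := by
        rw [show (J.flood v (J.col u)).1 = (I c).1 from h1]
        have : sz (I c) = 1 + sz (I c).1 + sz (I c).2 := rfl
        omega
      have h9 := sz_append o [(v, J.col u)]
      rw [sz_cons, sz_nil, sz_prod] at h9
      have h10 := hcol u
      have h11 := sz_le_of_mem (hverts ▸ hv)
      simp only [sz_prod]
      omega

end PolyTime

end

/-! ### Reverse painting with pivots -/

section Pivots

variable {V C : Type*} {A : V → V → Prop} {c : V → C} {S S' W W' T H : Set V} {u v q : V}

/-- `u` can be reached from `v` by a path whose vertices other than `v` are in `S`. -/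
def Conn (A : V → V → Prop) (S : Set V) : V → V → Prop :=
  Relation.ReflTransGen fun a b => A a b ∧ b ∈ S

theorem Conn.mono (h : Conn A S v u) (hS : S ⊆ S') : Conn A S' v u :=
  Relation.ReflTransGen.mono (fun _ _ h => ⟨h.1, hS h.2⟩) _ _ h

theorem Conn.mem (h : Conn A S v u) (hv : v ∈ S) : u ∈ S := by
  rcases Relation.ReflTransGen.cases_tail h with h | ⟨_, _, h⟩
  · exact h ▸ hv
  · exact h.2

theorem Conn.symm (hA : ∀ ⦃a b⦄, A a b → A b a) (h : Conn A S v u) (hv : v ∈ S) : Conn A S u v := by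
  induction h with
  | refl => exact .refl
  | tail hab hbc ih => exact .head ⟨hA hbc.1, Conn.mem hab hv⟩ ih

/-- A set without edges to its complement contains the vertices reachable from its elements. -/
theorem Conn.mem_of_closed (hH : ∀ a b, a ∈ H → A a b → b ∈ H) (h : Conn A S v u) (hv : v ∈ H) :
    u ∈ H := by
  induction h with
  | refl => exact hv
  | tail _ hbc ih => exact hH _ _ ih hbc.1

/-- The vertices that are finished after a stroke, going backwards in time: `W` is the set of
vertices that later strokes repaint, and the stroke with pivot `v` and its colour paints as much
as possible. -/
def step (A : V → V → Prop) (c : V → C) (W : Set V) (v : V) : Set V :=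
  W ∪ {u | Conn A {x | x ∈ W ∨ c x = c v} v u}

/-- The finished vertices after the strokes with the pivots in a list, going backwards in time. -/
def run (A : V → V → Prop) (c : V → C) (W : Set V) (Q : List V) : Set V :=
  Q.foldl (step A c) W

theorem subset_step : W ⊆ step A c W v := Set.subset_union_left

theorem self_mem_step : v ∈ step A c W v := Or.inr .refl

theorem color_eq_of_mem_step (h : u ∈ step A c W v) (hu : u ∉ W) : c u = c v :=
  (Conn.mem (h.resolve_left hu) (Or.inr rfl : v ∈ {x | x ∈ W ∨ c x = c v})).resolve_left hu

/-- Every newly finished vertex may serve as the pivot. -/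
theorem step_subset_step (hA : ∀ ⦃a b⦄, A a b → A b a) (hW : W ⊆ W')
    (h : u ∈ step A c W v) (hu : u ∉ W') :
    step A c W v ⊆ step A c W' u := by
  have hu' : u ∉ W := fun h => hu (hW h)
  have hc := color_eq_of_mem_step h hu'
  rintro x (hx | hx)
  · exact Or.inl (hW hx)
  · have h1 := (h.resolve_left hu').symm hA (Or.inr rfl)
    exact Or.inr (Conn.mono (h1.trans hx) fun y hy =>
      hy.imp (fun h => hW h) fun h => h.trans hc.symm)

theorem subset_run (Q : List V) : W ⊆ run A c W Q := by
  induction Q generalizing W with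
  | nil => exact subset_rfl
  | cons q Q ih => exact subset_step.trans ih

theorem run_append (Q R : List V) : run A c W (Q ++ R) = run A c (run A c W Q) R :=
  List.foldl_append

theorem mem_run_of_mem {Q : List V} (hq : q ∈ Q) (h : ∀ W', W ⊆ W' → u ∈ step A c W' q) :
    u ∈ run A c W Q := by
  induction Q generalizing W with
  | nil => simp at hq
  | cons p Q ih =>
    rcases List.mem_cons.1 hq with rfl | hq
    · exact subset_run Q (h W subset_rfl)
    · exact ih hq fun W' hW' => h W' (subset_step.trans hW')

/-- Pivots outside a union of connected components have no influence on it. -/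
theorem run_inter_subset_run_filter (hA : ∀ ⦃a b⦄, A a b → A b a)
    (hH : ∀ a b, a ∈ H → A a b → b ∈ H)
    [DecidablePred (· ∈ H)] (Q : List V) (hW : W ∩ H ⊆ W') :
    run A c W Q ∩ H ⊆ run A c W' (Q.filter (· ∈ H)) := by
  induction Q generalizing W W' with
  | nil => exact hW
  | cons q Q ih =>
    by_cases hq : q ∈ H
    · rw [List.filter_cons_of_pos (by simpa using hq)]
      refine ih ?_
      rintro x ⟨hx | hx, hxH⟩
      · exact subset_step (hW ⟨hx, hxH⟩)
      · have : Conn A ({y | y ∈ W ∨ c y = c q} ∩ H) q x := by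
          clear hxH
          induction hx with
          | refl => exact .refl
          | tail hab hbc ih =>
            exact .tail ih ⟨hbc.1, hbc.2, hH _ _ (Conn.mem ih ⟨Or.inr rfl, hq⟩).2 hbc.1⟩
        exact Or.inr (this.mono fun y hy => hy.1.imp (fun h => hW ⟨h, hy.2⟩) fun h => h)
    · rw [List.filter_cons_of_neg (by simpa using hq)]
      refine ih ?_
      rintro x ⟨hx | hx, hxH⟩
      · exact hW ⟨hx, hxH⟩
      · exact absurd hxH (Conn.mem_of_closed (H := Hᶜ)
          (fun a b ha hab hb => ha (hH _ _ hb (hA hab))) hx hq)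

/-- The number of the colours of the unfinished vertices in `T`. -/
noncomputable def missing (c : V → C) (T W : Set V) : ℕ := (c '' (T \ W)).ncard

theorem missing_eq_zero (h : T ⊆ W) : missing c T W = 0 := by
  rw [missing, Set.sdiff_eq_empty.2 h, Set.image_empty, Set.ncard_empty]

theorem missing_anti (hT : T.Finite) (h : W ⊆ W') : missing c T W' ≤ missing c T W :=
  Set.ncard_le_ncard (Set.image_mono (Set.sdiff_subset_sdiff_right h)) ((hT.sdiff).image c)

theorem missing_le_succ (hT : T.Finite) : missing c T W ≤ missing c T (step A c W q) + 1 := by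
  refine (Set.ncard_le_ncard (t := insert (c q) (c '' (T \ step A c W q))) ?_
    (((hT.sdiff).image c).insert _)).trans (Set.ncard_insert_le _ _)
  rintro _ ⟨x, ⟨hx, hxW⟩, rfl⟩
  by_cases h : x ∈ step A c W q
  · exact Or.inl (color_eq_of_mem_step h hxW)
  · exact Or.inr ⟨x, ⟨hx, h⟩, rfl⟩

theorem succ_missing_le (hT : T.Finite) (hq : q ∈ T) (hqW : q ∉ W)
    (h : ∀ x ∈ T, c x = c q → x ∈ step A c W q) :
    missing c T (step A c W q) + 1 ≤ missing c T W := by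
  have hlt : c '' (T \ step A c W q) ⊂ c '' (T \ W) := by
    refine (Set.ssubset_iff_of_subset
      (Set.image_mono (Set.sdiff_subset_sdiff_right subset_step))).2 ⟨c q, ⟨q, ⟨hq, hqW⟩, rfl⟩, ?_⟩
    rintro ⟨x, ⟨hx, hxs⟩, hxq⟩
    exact hxs (h x hx hxq)
  exact Set.ncard_lt_ncard hlt ((hT.sdiff).image c)

theorem missing_le_length (hT : T.Finite) (Q : List V) (h : T ⊆ run A c W Q) :
    missing c T W ≤ Q.length := by
  induction Q generalizing W with
  | nil => exact (missing_eq_zero h).le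
  | cons q Q ih =>
    have h1 := ih (W := step A c W q) h
    have h2 := missing_le_succ (A := A) (c := c) (W := W) (q := q) hT
    rw [List.length_cons]
    omega

/-- Compare a sequence `Q` of pivots with a set `W'` in which no pivot completes a colour. When `Q`
leaves `W'`, it has used a pivot that does not complete a colour, and the same vertices can be
finished by one pivot on top of `W'`. -/
theorem exists_pivot_of_not_subset (hA : ∀ ⦃a b⦄, A a b → A b a) (hH : ∀ a b, a ∈ H → A a b → b ∈ H)
    (hT : T.Finite) (hTH : ∀ u ∈ H, ∀ w ∈ T, c u = c w → u ∈ T) (hW : W ⊆ W')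
    (hW' : ∀ u ∈ T, u ∉ W' → ¬ ∀ x ∈ T, c x = c u → x ∈ step A c W' u)
    {Q : List V} (hQ : ∀ q ∈ Q, q ∈ H) (hTQ : T ⊆ run A c W Q) (hTW' : ¬ T ⊆ W') :
    ∃ u ∈ H, ∃ (W₁ : Set V) (R : List V), W₁ ⊆ step A c W' u ∧ (∀ q ∈ R, q ∈ H) ∧
      T ⊆ run A c W₁ R ∧ R.length + missing c T W + 1 ≤ Q.length + missing c T W₁ := by
  induction Q generalizing W with
  | nil => exact absurd (Set.Subset.trans hTQ hW) hTW'
  | cons q Q ih =>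
    have hq := hQ q (by simp)
    have hQ' : ∀ q ∈ Q, q ∈ H := fun p hp => hQ p (by simp [hp])
    by_cases h : step A c W q ⊆ W'
    · obtain ⟨u, hu, W₁, R, h1, h2, h3, h4⟩ := ih h hQ' hTQ
      refine ⟨u, hu, W₁, R, h1, h2, h3, ?_⟩
      have := missing_le_succ (A := A) (c := c) (W := W) (q := q) hT
      rw [List.length_cons]
      omega
    · obtain ⟨u, hu, huW'⟩ := Set.not_subset.1 h
      have huW : u ∉ W := fun h => huW' (hW h)
      have huH : u ∈ H := (hu.resolve_left huW).mem_of_closed hH hq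
      have hsub := step_subset_step hA hW hu huW'
      have hcu := color_eq_of_mem_step hu huW
      refine ⟨u, huH, step A c W q, Q, hsub, hQ', hTQ, ?_⟩
      have : missing c T W ≤ missing c T (step A c W q) := by
        refine Set.ncard_le_ncard ?_ ((hT.sdiff).image c)
        rintro _ ⟨x, ⟨hx, hxW⟩, rfl⟩
        by_contra hcx
        have hcompl (y : V) (hy : y ∈ T) (hyx : c y = c x) : y ∈ step A c W q := by
          by_contra hys
          exact hcx ⟨y, ⟨hy, hys⟩, hyx⟩
        have hxu : c x = c u :=
          (color_eq_of_mem_step (hcompl x hx rfl) hxW).trans hcu.symm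
        exact hW' u (hTH u huH x hx hxu.symm) huW' fun y hy hyu =>
          hsub (hcompl y hy (hyu.trans hxu.symm))
      rw [List.length_cons]
      omega

/-- After the pivots of a connected dominating set, each colour needs only one more pivot. -/
theorem exists_pivots_of_dominating (hA : ∀ ⦃a b⦄, A a b → A b a) (hT : T.Finite)
    (hTH : T ⊆ H) {D : List V}
    (hD : ∀ a ∈ D, ∀ b ∈ D, Conn A {x | x ∈ D} a b)
    (hdom : ∀ u ∈ H, u ∈ D ∨ ∃ a ∈ D, A a u) (W : Set V) :
    ∃ Q : List V, (∀ q ∈ Q, q ∈ D ∨ q ∈ T) ∧ Q.length = D.length + missing c T ∅ ∧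
      T ⊆ run A c W Q := by
  obtain ⟨R, hRT, hR⟩ := Set.exists_subset_bijOn T c
  have hRf := hT.subset hRT
  refine ⟨D ++ hRf.toFinset.toList, ?_, ?_, ?_⟩
  · intro q hq
    simp only [List.mem_append, Finset.mem_toList, Set.Finite.mem_toFinset] at hq
    exact hq.imp (fun h => h) fun h => hRT h
  · rw [List.length_append, Finset.length_toList, missing, Set.sdiff_empty,
      ← hR.image_eq, hR.injOn.ncard_image, Set.ncard_eq_toFinset_card R hRf]
  · intro x hx
    obtain ⟨r, hr, hrx⟩ := hR.surjOn ⟨x, hx, rfl⟩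
    rw [run_append]
    refine mem_run_of_mem (q := r) (by simpa using hr) fun W' hW' => ?_
    have hDW' : ∀ a ∈ D, a ∈ W' := fun a ha => hW' (mem_run_of_mem ha fun _ _ => self_mem_step)
    have hDS {a b : V} (ha : a ∈ D) (hb : b ∈ D) :
        Conn A {y | y ∈ W' ∨ c y = c r} a b :=
      (hD a ha b hb).mono fun y hy => Or.inl (hDW' y hy)
    refine Or.inr ?_
    have h1 : ∃ d ∈ D, Conn A {y | y ∈ W' ∨ c y = c r} r d := by
      rcases hdom r (hTH (hRT hr)) with h | ⟨d, hd, h⟩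
      · exact ⟨r, h, .refl⟩
      · exact ⟨d, hd, .single ⟨hA h, Or.inl (hDW' d hd)⟩⟩
    obtain ⟨d, hd, h1⟩ := h1
    rcases hdom x (hTH hx) with h | ⟨e, he, h⟩
    · exact h1.trans (hDS hd h)
    · exact (h1.trans (hDS hd he)).tail ⟨h, Or.inr hrx.symm⟩

end Pivots

/-! ### Connected dominating sets in co-gem-free graphs -/

section Dominating

variable {V : Type*} {G : SimpleGraph V}

theorem CoGemFree.adj_of_path (hG : CoGemFree G) {a b c d u : V} (hab : G.Adj a b)
    (hbc : G.Adj b c) (hcd : G.Adj c d) (hac : ¬ G.Adj a c) (had : ¬ G.Adj a d)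
    (hbd : ¬ G.Adj b d) (ha : u ≠ a) (hb : u ≠ b) (hc : u ≠ c) (hd : u ≠ d) :
    G.Adj a u ∨ G.Adj b u ∨ G.Adj c u ∨ G.Adj d u := by
  by_contra! h
  obtain ⟨h1, h2, h3, h4⟩ := h
  have hac' : a ≠ c := fun h => had (h ▸ hcd)
  have had' : a ≠ d := fun h => hac (h ▸ hcd.symm)
  have hbd' : b ≠ d := fun h => had (h ▸ hab)
  let f : Fin 4 ⊕ Fin 1 → V := Sum.elim ![a, b, c, d] ![u]
  have hf : Function.Injective f := by
    rintro (i | i) (j | j) h <;> fin_cases i <;> fin_cases j <;>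
      simp [f, hab.ne, hab.ne', hbc.ne, hbc.ne', hcd.ne, hcd.ne', hac', hac'.symm, had',
        had'.symm, hbd', hbd'.symm, ha, ha.symm, hb, hb.symm, hc, hc.symm, hd, hd.symm] at h ⊢
  refine hG ⟨⟨f, hf⟩, ?_⟩
  rintro (i | i) (j | j) <;> fin_cases i <;> fin_cases j <;>
    simp [f, coGem, SimpleGraph.pathGraph_adj, hab, hab.symm, hbc, hbc.symm, hcd, hcd.symm, hac,
      had, hbd, h1, h2, h3, h4, G.adj_comm u, G.adj_comm c a, G.adj_comm d a, G.adj_comm d b]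

/-- In a co-gem-free graph, every induced path on four vertices dominates the graph. A connected
graph without such paths is dominated by a vertex or an edge: an edge that dominates as many
vertices as possible. -/
theorem CoGemFree.exists_dominating [Finite V] (hG : CoGemFree G) (v : V) :
    ∃ D : List V, D.length ≤ 4 ∧ (∀ a ∈ D, G.Reachable v a) ∧
      (∀ a ∈ D, ∀ b ∈ D, Conn G.Adj {x | x ∈ D} a b) ∧
      ∀ u, G.Reachable v u → u ∈ D ∨ ∃ a ∈ D, G.Adj a u := by
  by_cases hP : ∃ a b c d, G.Reachable v a ∧ G.Adj a b ∧ G.Adj b c ∧ G.Adj c d ∧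
      ¬ G.Adj a c ∧ ¬ G.Adj a d ∧ ¬ G.Adj b d
  · obtain ⟨a, b, c, d, hva, hab, hbc, hcd, hac, had, hbd⟩ := hP
    have hvb := hva.trans hab.reachable
    have hvc := hvb.trans hbc.reachable
    have hvd := hvc.trans hcd.reachable
    refine ⟨[a, b, c, d], by simp, by simp [hva, hvb, hvc, hvd], ?_, ?_⟩
    · let S : Set V := {x | x ∈ [a, b, c, d]}
      have hA : ∀ ⦃a b⦄, G.Adj a b → G.Adj b a := fun _ _ h => h.symm
      have h1 : Conn G.Adj S a b := .single ⟨hab, by simp [S]⟩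
      have h2 : Conn G.Adj S a c := h1.tail ⟨hbc, by simp [S]⟩
      have h3 : Conn G.Adj S a d := h2.tail ⟨hcd, by simp [S]⟩
      have h4 : ∀ x ∈ [a, b, c, d], Conn G.Adj S a x := by
        simp only [List.mem_cons, List.not_mem_nil, or_false, forall_eq_or_imp, forall_eq]
        exact ⟨.refl, h1, h2, h3⟩
      exact fun x hx y hy => ((h4 x hx).symm hA (by simp [S])).trans (h4 y hy)
    · intro u _
      by_cases h : u ∈ [a, b, c, d]
      · exact Or.inl h
      · simp only [List.mem_cons, List.not_mem_nil, or_false, not_or] at h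
        have := hG.adj_of_path hab hbc hcd hac had hbd h.1 h.2.1 h.2.2.1 h.2.2.2
        simpa using Or.inr this
  by_cases hv : ∃ w, G.Adj v w
  · obtain ⟨w, hvw⟩ := hv
    let N (e : V × V) : Set V := {u | u = e.1 ∨ u = e.2 ∨ G.Adj e.1 u ∨ G.Adj e.2 u}
    have hfin : {e : V × V | G.Reachable v e.1 ∧ G.Adj e.1 e.2}.Finite := Set.toFinite _
    obtain ⟨⟨x, y⟩, ⟨hvx, hxy⟩, hmax⟩ := Set.exists_max_image _ (fun e => (N e).ncard) hfin
      ⟨(v, w), .refl v, hvw⟩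
    simp only at hvx hxy
    have hvy := hvx.trans hxy.reachable
    -- An undominated vertex `z` with a dominated neighbour `p` yields a better edge.
    have key (x y p z : V) (hvx : G.Reachable v x) (hxy : G.Adj x y) (hxp : G.Adj x p)
        (hpz : G.Adj p z) (hz : z ∉ N (x, y)) :
        ∃ e : V × V, (G.Reachable v e.1 ∧ G.Adj e.1 e.2) ∧ N (x, y) ⊂ N e := by
      simp only [N, Set.mem_ofPred_eq, not_or] at hz
      obtain ⟨hzx, hzy, hxz, hyz⟩ := hz
      have hyp : G.Adj y p := by
        by_contra hyp
        refine hP ⟨y, x, p, z, hvx.trans hxy.reachable, hxy.symm, hxp, hpz, hyp, hyz, hxz⟩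
      refine ⟨(x, p), ⟨hvx, hxp⟩, ?_⟩
      refine (Set.ssubset_iff_of_subset ?_).2 ⟨z, Or.inr (Or.inr (Or.inr hpz)), ?_⟩
      · rintro u (rfl | rfl | hu | hu)
        · exact Or.inl rfl
        · exact Or.inr (Or.inr (Or.inl hxy))
        · exact Or.inr (Or.inr (Or.inl hu))
        · by_contra hN
          simp only [N, Set.mem_ofPred_eq, not_or] at hN
          obtain ⟨-, -, hxu, hpu⟩ := hN
          simp only at hu
          by_cases huz : G.Adj u z
          · exact hP ⟨x, y, u, z, hvx, hxy, hu, huz, hxu, hxz, hyz⟩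
          · exact hP ⟨z, p, y, u, ((hvx.trans hxp.reachable).trans hpz.reachable),
              hpz.symm, hyp.symm, hu, fun h => hyz h.symm, fun h => huz h.symm, hpu⟩
      · simp [N, hzx, hzy, hxz, hyz]
    refine ⟨[x, y], by simp, by simp [hvx, hvy], ?_, ?_⟩
    · simp only [List.mem_cons, List.not_mem_nil, or_false, forall_eq_or_imp, forall_eq]
      exact ⟨⟨.refl, .single ⟨hxy, by simp⟩⟩, .single ⟨hxy.symm, by simp⟩, .refl⟩
    · have hdom : ∀ u, G.Reachable v u → u ∈ N (x, y) := by
        intro u hu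
        have hxu := (SimpleGraph.reachable_iff_reflTransGen _ _).1 (hvx.symm.trans hu)
        induction hxu with
        | refl => exact Or.inl rfl
        | @tail p z _ hpz ih =>
          by_contra hz
          have hp := ih (hu.trans hpz.symm.reachable)
          have hbetter : ∃ e : V × V, (G.Reachable v e.1 ∧ G.Adj e.1 e.2) ∧ N (x, y) ⊂ N e := by
            rcases hp with rfl | rfl | hp | hp
            · exact absurd (Or.inr (Or.inr (Or.inl hpz))) hz
            · exact absurd (Or.inr (Or.inr (Or.inr hpz))) hz
            · exact key x y p z hvx hxy hp hpz hz
            · have hN : N (y, x) = N (x, y) := by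
                ext u
                simp only [N, Set.mem_ofPred_eq]
                tauto
              rw [← hN] at hz ⊢
              exact key y x p z hvy hxy.symm hp hpz hz
          obtain ⟨e, he, hlt⟩ := hbetter
          exact absurd (hmax e he) (not_le.2 (Set.ncard_lt_ncard hlt (Set.toFinite _)))
      intro u hu
      have := hdom u hu
      simp only [N, Set.mem_ofPred_eq] at this
      simp only [List.mem_cons, List.not_mem_nil, or_false, exists_eq_or_imp, exists_eq_left]
      tauto
  · refine ⟨[v], by simp, by simp, by simp only [List.mem_singleton, forall_eq]; exact .refl,
      fun u hu => ?_⟩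
    rcases Relation.ReflTransGen.cases_head
      ((SimpleGraph.reachable_iff_reflTransGen _ _).1 hu) with h | ⟨w, h, _⟩
    · simp [h]
    · exact absurd ⟨w, h⟩ hv

end Dominating

/-! ### Paint plans and pivots -/

section Painting

variable {V C : Type*} {G : SimpleGraph V} {t : V → C}

theorem Conn.of_preconnected {S : Set V} (hS : (G.induce S).Preconnected) {a b : V} (ha : a ∈ S)
    (hb : b ∈ S) : Conn G.Adj S a b := by
  have h := (SimpleGraph.reachable_iff_reflTransGen _ _).1 (hS ⟨a, ha⟩ ⟨b, hb⟩)
  exact h.lift (p := fun a b => G.Adj a b ∧ b ∈ S) Subtype.val fun x y hxy => ⟨hxy, y.2⟩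

/-- The vertices reachable from a vertex form a connected set. -/
theorem preconnected_setOf_conn {S : Set V} {v : V} :
    (G.induce {u | Conn G.Adj S v u}).Preconnected := by
  have key (u : V) (hu : Conn G.Adj S v u) :
      (G.induce {u | Conn G.Adj S v u}).Reachable ⟨v, .refl⟩ ⟨u, hu⟩ := by
    induction hu with
    | refl => exact .refl _
    | tail hab hbc ih =>
      exact ih.trans (SimpleGraph.Adj.reachable (G := G.induce {u | Conn G.Adj S v u}) hbc.1)
  exact fun a b => (key a a.2).symm.trans (key b b.2)

/-- Every paint plan yields a sequence of pivots of at most the same length: go through the strokes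
from the last one to the first one, and skip those that finish no vertex. -/
theorem exists_pivots_of_strokes [DecidableEq V] (P : List (Stroke V C)) (p₀ : V → Option C)
    (W : Set V)
    (hP : ∀ s ∈ P, (G.induce (s.area : Set V)).Preconnected)
    (h : ∀ v ∉ W, P.foldl Stroke.apply p₀ v = some (t v)) :
    ∃ Q : List V, Q.length ≤ P.length ∧ ∀ v, p₀ v ≠ some (t v) → v ∈ run G.Adj t W Q := by
  induction P using List.reverseRecOn generalizing W with
  | nil => exact ⟨[], le_rfl, fun v hv => by_contra fun hW => hv (h v hW)⟩
  | append_singleton P s ih =>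
    have hP' : ∀ s ∈ P, (G.induce (s.area : Set V)).Preconnected := fun s hs => hP s (by simp [hs])
    have hs := hP s (by simp)
    rw [List.foldl_append] at h
    simp only [List.foldl_cons, List.foldl_nil, Stroke.apply] at h
    by_cases hsub : (s.area : Set V) ⊆ W
    · obtain ⟨Q, hQ, hrun⟩ := ih W hP' fun v hv => by
        simpa [show v ∉ s.area from fun hvs => hv (hsub hvs)] using h v hv
      exact ⟨Q, by simp; omega, hrun⟩
    · obtain ⟨q, hq, hqW⟩ := Set.not_subset.1 hsub
      have hcol : ∀ v ∈ s.area, v ∉ W → t v = s.color := fun v hv hvW => by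
        simpa [hv, eq_comm] using h v hvW
      have harea : (s.area : Set V) ⊆ step G.Adj t W q := fun v hv =>
        Or.inr ((Conn.of_preconnected hs hq hv).mono fun x hx => by
          by_cases hxW : x ∈ W
          · exact Or.inl hxW
          · exact Or.inr ((hcol x hx hxW).trans (hcol q hq hqW).symm))
      obtain ⟨Q, hQ, hrun⟩ := ih (step G.Adj t W q) hP' fun v hv => by
        simpa [show v ∉ s.area from fun hvs => hv (harea hvs)] using
          h v fun hvW => hv (subset_step hvW)
      exact ⟨q :: Q, by simp; omega, hrun⟩

open Classical in
/-- The strokes with the given pivots, in the order of painting: the stroke with the first pivot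
comes last. -/
noncomputable def pivotStrokes [Fintype V] (G : SimpleGraph V) (t : V → C) :
    Set V → List V → List (Stroke V C)
  | _, [] => []
  | W, q :: Q => pivotStrokes G t (step G.Adj t W q) Q ++
      [⟨{u | Conn G.Adj {x | x ∈ W ∨ t x = t q} q u}.toFinset, t q⟩]

variable [Fintype V]

theorem length_pivotStrokes (W : Set V) (Q : List V) :
    (pivotStrokes G t W Q).length = Q.length := by
  induction Q generalizing W with
  | nil => rfl
  | cons q Q ih => simp [pivotStrokes, ih]

open Classical in
theorem preconnected_of_mem_pivotStrokes {W : Set V} {Q : List V} :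
    ∀ s ∈ pivotStrokes G t W Q, (G.induce (s.area : Set V)).Preconnected := by
  induction Q generalizing W with
  | nil => simp [pivotStrokes]
  | cons q Q ih =>
    intro s hs
    rcases List.mem_append.1 hs with hs | hs
    · exact ih s hs
    · obtain rfl := List.mem_singleton.1 hs
      change (G.induce ((Set.toFinset _ : Finset V) : Set V)).Preconnected
      rw [Set.coe_toFinset]
      exact preconnected_setOf_conn

theorem exists_color_of_mem_pivotStrokes {W : Set V} {Q : List V} :
    ∀ s ∈ pivotStrokes G t W Q, ∃ v, t v = s.color := by
  induction Q generalizing W with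
  | nil => simp [pivotStrokes]
  | cons q Q ih =>
    intro s hs
    rcases List.mem_append.1 hs with hs | hs
    · exact ih s hs
    · obtain rfl := List.mem_singleton.1 hs
      exact ⟨q, rfl⟩

open Classical in
theorem foldl_pivotStrokes [DecidableEq V] (p₀ : V → Option C) {W : Set V} (Q : List V)
    {v : V} (hv : v ∉ W) :
    (pivotStrokes G t W Q).foldl Stroke.apply p₀ v =
      if v ∈ run G.Adj t W Q then some (t v) else p₀ v := by
  induction Q generalizing W with
  | nil => simp [pivotStrokes, run, hv]
  | cons q Q ih =>
    rw [pivotStrokes, List.foldl_append]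
    simp only [List.foldl_cons, List.foldl_nil, Stroke.apply, Set.mem_toFinset, Set.mem_ofPred_eq]
    split_ifs with h1 h2 h2
    · rw [color_eq_of_mem_step (c := t) (Or.inr h1) hv]
    · exact absurd (subset_run Q (Or.inr h1)) h2
    · exact (ih (fun h => h.elim hv h1)).trans (if_pos h2)
    · exact (ih (fun h => h.elim hv h1)).trans (if_neg h2)

end Painting

/-! ### Flooding and painting -/

section Flooding

variable {V C : Type*} {G : SimpleGraph V} {t t' : V → C} {c : C}

theorem reachable_sameColorGraph_iff {p : V → C} {u v : V} :
    (sameColorGraph G p).Reachable v u ↔ Conn G.Adj {x | p x = p v} v u := by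
  rw [SimpleGraph.reachable_iff_reflTransGen]
  constructor <;> intro h
  · induction h with
    | refl => exact .refl
    | tail _ hbc ih => exact .tail ih ⟨hbc.1,
        hbc.2.symm.trans (Conn.mem (S := {x | p x = p v}) ih rfl)⟩
  · induction h with
    | refl => exact .refl
    | tail hab hbc ih => exact .tail ih ⟨hbc.1, (Conn.mem hab rfl).trans hbc.2.symm⟩

open Classical in
theorem Move.apply_eq (p : V → C) (m : Move V C) (u : V) :
    m.apply G p u = if Conn G.Adj {x | p x = p m.pivot} m.pivot u then m.color else p u := by
  simp only [Move.apply, reachable_sameColorGraph_iff]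

/-- Undoing a move is a stroke. -/
theorem exists_strokes_of_moves [Fintype V] [DecidableEq V] (S : List (Move V C))
    (hS : ∀ v, S.foldl (Move.apply G) t v = c) :
    ∃ P : List (Stroke V C), P.length = S.length ∧
      (∀ s ∈ P, (G.induce (s.area : Set V)).Preconnected) ∧
      P.foldl Stroke.apply (fun _ => some c) = fun v => some (t v) := by
  classical
  induction S generalizing t with
  | nil => exact ⟨[], rfl, by simp, funext fun v => congrArg some (hS v).symm⟩
  | cons m S ih =>
    obtain ⟨P, hPl, hP, hPt⟩ := ih (t := m.apply G t) hS
    refine ⟨P ++ [⟨{u | Conn G.Adj {x | t x = t m.pivot} m.pivot u}.toFinset, t m.pivot⟩],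
      by simp [hPl], ?_, ?_⟩
    · intro s hs
      rcases List.mem_append.1 hs with hs | hs
      · exact hP s hs
      · obtain rfl := List.mem_singleton.1 hs
        change (G.induce ((Set.toFinset _ : Finset V) : Set V)).Preconnected
        rw [Set.coe_toFinset]
        exact preconnected_setOf_conn
    · rw [List.foldl_append, hPt]
      funext v
      simp only [List.foldl_cons, List.foldl_nil, Stroke.apply, Set.mem_toFinset,
        Set.mem_ofPred_eq, Move.apply_eq]
      split_ifs with h
      · exact congrArg some (Conn.mem h rfl : v ∈ {x | t x = t m.pivot}).symm
      · rfl

/-- Consider two colourings that agree outside the colour component of `b` in `t`. A flooding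
sequence for `t'` can be imitated on `t`, with one additional move: whenever the flooded component
meets the component of `b`, flood the latter with the old colour of the former, so that both
merge. The last move gives the component of `b` its final colour. -/
theorem exists_moves_of_agree {R : Set C} (hc : c ∈ R) {b : V} (S' : List (Move V C))
    (ht' : ∀ v, t' v ∈ R) (hS'R : ∀ m ∈ S', m.color ∈ R)
    (hS' : ∀ v, S'.foldl (Move.apply G) t' v = c)
    (h : ∀ v, ¬ Conn G.Adj {x | t x = t b} b v → t v = t' v) :
    ∃ S : List (Move V C), S.length = S'.length + 1 ∧ (∀ m ∈ S, m.color ∈ R) ∧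
      ∀ v, S.foldl (Move.apply G) t v = c := by
  classical
  have hA : ∀ ⦃a b⦄, G.Adj a b → G.Adj b a := fun _ _ h => h.symm
  induction S' generalizing t t' with
  | nil =>
    refine ⟨[⟨b, c⟩], rfl, by simpa using hc, fun v => ?_⟩
    simp only [List.foldl_cons, List.foldl_nil, Move.apply_eq]
    split_ifs with hv
    · rfl
    · exact (h v hv).trans (hS' v)
  | cons m S' ih =>
    have ht'' : ∀ v, m.apply G t' v ∈ R := fun v => by
      rw [Move.apply_eq]
      split_ifs
      · exact hS'R m (by simp)
      · exact ht' v
    have hS'R' : ∀ m ∈ S', m.color ∈ R := fun k hk => hS'R k (by simp [hk])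
    by_cases hmeet : ∃ y, Conn G.Adj {x | t' x = t' m.pivot} m.pivot y ∧
        Conn G.Adj {x | t x = t b} b y
    · obtain ⟨y, hyX, hyB⟩ := hmeet
      have hin (v : V) (hv : Conn G.Adj {x | t x = t b} b v) :
          Move.apply G t ⟨b, t' m.pivot⟩ v = t' m.pivot := by
        rw [Move.apply_eq, if_pos hv]
      have hout (v : V) (hv : ¬ Conn G.Adj {x | t x = t b} b v) :
          Move.apply G t ⟨b, t' m.pivot⟩ v = t' v := by
        rw [Move.apply_eq, if_neg hv, h v hv]
      have hb := hin b .refl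
      have hB (v : V) (hv : Conn G.Adj {x | t x = t b} b v) :
          Conn G.Adj {x | Move.apply G t ⟨b, t' m.pivot⟩ x =
            Move.apply G t ⟨b, t' m.pivot⟩ b} b v := by
        induction hv with
        | refl => exact .refl
        | tail hab hbc ih => exact .tail ih ⟨hbc.1, (hin _ (.tail hab hbc)).trans hb.symm⟩
      have hX (v : V) (hv : Conn G.Adj {x | t' x = t' m.pivot} m.pivot v) :
          Conn G.Adj {x | Move.apply G t ⟨b, t' m.pivot⟩ x =
            Move.apply G t ⟨b, t' m.pivot⟩ b} b v := by
        refine (hB y hyB).trans (Conn.mono ((hyX.symm hA rfl).trans hv) fun w hw => ?_)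
        refine Eq.trans ?_ hb.symm
        by_cases hwB : Conn G.Adj {x | t x = t b} b w
        · exact hin w hwB
        · exact (hout w hwB).trans hw
      obtain ⟨S, hSl, hSR, hS⟩ := ih (t := Move.apply G t ⟨b, t' m.pivot⟩) ht'' hS'R' hS'
        fun v hv => by
          rw [hout v fun hvB => hv (hB v hvB), Move.apply_eq, if_neg fun hvX => hv (hX v hvX)]
      exact ⟨⟨b, t' m.pivot⟩ :: S, by simp [hSl], by simpa using ⟨ht' _, hSR⟩, hS⟩
    · have hdisj (v : V) (hv : Conn G.Adj {x | t' x = t' m.pivot} m.pivot v) :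
          ¬ Conn G.Adj {x | t x = t b} b v := fun hvB => hmeet ⟨v, hv, hvB⟩
      have hpiv := h m.pivot (hdisj _ .refl)
      have hiff (v : V) : Conn G.Adj {x | t x = t m.pivot} m.pivot v ↔
          Conn G.Adj {x | t' x = t' m.pivot} m.pivot v := by
        constructor <;> intro hv
        · induction hv with
          | refl => exact .refl
          | @tail w v _ hwv ih =>
            refine .tail ih ⟨hwv.1, ?_⟩
            have hw := hdisj w ih
            have htw : t w = t m.pivot := (h w hw).trans ((Conn.mem ih rfl : _ ∈ _).trans hpiv.symm)
            by_cases hvB : Conn G.Adj {x | t x = t b} b v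
            · -- Then `w` would belong to the colour component of `b`, too.
              exact absurd (hvB.tail ⟨hwv.1.symm,
                (htw.trans hwv.2.symm).trans (Conn.mem hvB rfl : _ ∈ _)⟩) hw
            · exact (h v hvB).symm.trans (hwv.2.trans hpiv)
        · induction hv with
          | refl => exact .refl
          | @tail w v hw hwv ih =>
            exact .tail ih ⟨hwv.1, (h v (hdisj v (.tail hw hwv))).trans (hwv.2.trans hpiv.symm)⟩
      have hin (v : V) (hv : Conn G.Adj {x | t x = t b} b v) : m.apply G t v = t v := by
        rw [Move.apply_eq, if_neg fun hvX => hdisj v ((hiff v).1 hvX) hv]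
      have hB (v : V) (hv : Conn G.Adj {x | t x = t b} b v) :
          Conn G.Adj {x | m.apply G t x = m.apply G t b} b v := by
        induction hv with
        | refl => exact .refl
        | tail hab hbc ih =>
          exact .tail ih ⟨hbc.1, (hin _ (.tail hab hbc)).trans (hbc.2.trans (hin b .refl).symm)⟩
      obtain ⟨S, hSl, hSR, hS⟩ := ih (t := m.apply G t) ht'' hS'R' hS' fun v hv => by
        rw [Move.apply_eq, Move.apply_eq, h v fun hvB => hv (hB v hvB)]
        simp only [hiff]
      exact ⟨m :: S, by simp [hSl], by simpa using ⟨hS'R m (by simp), hSR⟩, hS⟩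

theorem exists_eq_some_foldl [DecidableEq V] {R : Set C} (hc : c ∈ R) (P : List (Stroke V C))
    (hPR : ∀ s ∈ P, s.color ∈ R) : ∃ t : V → C, (∀ v, t v ∈ R) ∧
      P.foldl Stroke.apply (fun _ => some c) = fun v => some (t v) := by
  induction P using List.reverseRecOn with
  | nil => exact ⟨fun _ => c, fun _ => hc, rfl⟩
  | append_singleton P s ih =>
    obtain ⟨t, ht, hPt⟩ := ih fun s hs => hPR s (by simp [hs])
    refine ⟨fun v => if v ∈ s.area then s.color else t v, fun v => ?_, ?_⟩
    · simp only
      split_ifs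
      · exact hPR s (by simp)
      · exact ht v
    · rw [List.foldl_append, hPt]
      funext v
      simp only [List.foldl_cons, List.foldl_nil, Stroke.apply]
      split_ifs <;> rfl

/-- Strokes that produce `t` on a canvas of one colour can be undone by as many moves. -/
theorem exists_moves_of_strokes [DecidableEq V] {R : Set C} (hc : c ∈ R) (P : List (Stroke V C))
    (hPR : ∀ s ∈ P, s.color ∈ R)
    (hP : ∀ s ∈ P, (G.induce (s.area : Set V)).Preconnected)
    (hPt : P.foldl Stroke.apply (fun _ => some c) = fun v => some (t v)) :
    ∃ S : List (Move V C), S.length ≤ P.length ∧ (∀ m ∈ S, m.color ∈ R) ∧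
      ∀ v, S.foldl (Move.apply G) t v = c := by
  induction P using List.reverseRecOn generalizing t with
  | nil => exact ⟨[], le_rfl, by simp, fun v => (Option.some_injective _ (congrFun hPt v)).symm⟩
  | append_singleton P s ih =>
    have hPR' : ∀ s ∈ P, s.color ∈ R := fun s hs => hPR s (by simp [hs])
    obtain ⟨t', ht', hPt'⟩ := exists_eq_some_foldl hc P hPR'
    obtain ⟨S', hSl, hSR, hS'⟩ := ih hPR' (fun s hs => hP s (by simp [hs])) hPt'
    rw [List.foldl_append, hPt'] at hPt
    have hst (v : V) : t v = if v ∈ s.area then s.color else t' v := by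
      have := congrFun hPt v
      simp only [List.foldl_cons, List.foldl_nil, Stroke.apply] at this
      split_ifs at this ⊢ <;> exact (Option.some_injective _ this).symm
    rcases s.area.eq_empty_or_nonempty with hs | ⟨b, hb⟩
    · obtain rfl : t = t' := funext fun v => by simpa [hs] using hst v
      exact ⟨S', by simp; omega, hSR, hS'⟩
    · obtain ⟨S, hSl', hSR', hS⟩ := exists_moves_of_agree (t := t) (b := b) hc S' ht' hSR hS'
        fun v hv => by
          rw [hst v, if_neg]
          intro hvs
          refine hv ((Conn.of_preconnected (hP s (by simp)) hb hvs).mono fun x hx => ?_)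
          change t x = t b
          rw [hst x, hst b, if_pos (Finset.mem_coe.1 hx), if_pos hb]
      exact ⟨S, by simp; omega, hSR', hS⟩

end Flooding

/-! ### Correctness of the search for pivots -/

/-- Iteration of a function reaches a stable state if it decreases a measure in all other
states. -/
theorem iterate_stable {σ : Type*} {f : σ → σ} {μ : σ → ℕ} {inv p : σ → Prop}
    (hinv : ∀ s, inv s → inv (f s)) (h : ∀ s, inv s → p s ∨ μ (f s) < μ s)
    (hp : ∀ s, inv s → p s → p (f s)) (N : ℕ) {s : σ} (hs : inv s) (hμ : μ s ≤ N) :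
    p (f^[N] s) := by
  induction N generalizing s with
  | zero => exact (h s hs).resolve_right (by omega)
  | succ N ih =>
    rw [Function.iterate_succ_apply]
    rcases h s hs with h | h
    · clear ih hμ
      have h1 := hp s hs h
      have h2 := hinv s hs
      generalize f s = s' at h1 h2
      induction N generalizing s' with
      | zero => exact h1
      | succ N ih => exact ih _ (hp _ h2 h1) (hinv _ h2)
    · exact ih (hinv s hs) (by omega)

theorem select_le {σ α : Type*} [LinearOrder α] {r : σ → σ → Bool} (cost : σ → α)
    (hr : ∀ a b, r a b = true ↔ cost a < cost b) (s : σ) (l : List σ) :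
    ∀ x ∈ s :: l, cost (select r s l) ≤ cost x := by
  unfold select
  induction l generalizing s with
  | nil => simp
  | cons a l ih =>
    rw [List.foldl_cons]
    have h := ih (if r a s then a else s)
    have h1 := h _ (List.mem_cons_self ..)
    intro x hx
    simp only [List.mem_cons] at hx
    rcases hx with rfl | rfl | hx
    · refine h1.trans ?_
      split_ifs with hra
      · exact ((hr _ _).1 hra).le
      · exact le_rfl
    · refine h1.trans ?_
      split_ifs with hra
      · exact le_rfl
      · exact not_lt.1 fun hlt => hra ((hr _ _).2 hlt)
    · exact h x (by simp [hx])

namespace Instance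

/-- The set represented by a bit vector. -/
def toSet (W : List Bool) : Set ℕ := {v | mem W v = true}

/-- The adjacency relation of the graph. -/
def Adj (I : Instance) (u v : ℕ) : Prop := I.adj u v = true

/-- The adjacency matrix is symmetric and has the right size. -/
structure Valid (I : Instance) : Prop where
  symm : ∀ ⦃u v⦄, I.Adj u v → I.Adj v u
  lt : ∀ ⦃u v⦄, I.Adj u v → v < I.2.length

/-- All elements of the list are vertices. -/
def Pivots (I : Instance) (Q : List ℕ) : Prop := ∀ q ∈ Q, q < I.2.length

variable {I : Instance} {S T W : List Bool} {Q : List ℕ} {u v : ℕ}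

theorem mem_verts : v ∈ I.verts ↔ v < I.2.length := List.mem_range

theorem mem_toSet_tab {f : ℕ → Bool} : v ∈ toSet (I.tab f) ↔ v < I.2.length ∧ f v = true := by
  change mem _ _ = true ↔ _
  unfold mem tab verts
  rw [List.getD_eq_getElem?_getD, List.getElem?_map]
  by_cases h : v < I.2.length
  · simp [h]
  · simp [h]

theorem mem_toSet_grow {R : List Bool} : u ∈ toSet (I.grow S R) ↔
    u < I.2.length ∧ (u ∈ toSet R ∨ u ∈ toSet S ∧ ∃ w < I.2.length, w ∈ toSet R ∧ I.Adj w u) := by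
  unfold grow
  rw [mem_toSet_tab]
  simp [toSet, Adj, verts]

theorem mem_toSet_component (hI : I.Valid) (hv : v < I.2.length) :
    u ∈ toSet (I.component S v) ↔ Conn I.Adj (toSet S) v u := by
  have hfold : I.component S v =
      (I.grow S)^[I.2.length] (I.tab fun u => decide (u = v)) := by
    unfold component
    rw [List.foldl_const, length_verts]
  have hbound (R : List Bool) : ∀ x ∈ toSet (I.grow S R), x < I.2.length :=
    fun x hx => (mem_toSet_grow.1 hx).1
  rw [hfold]
  constructor
  · intro hu
    generalize I.2.length = N at hu
    induction N generalizing u with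
    | zero =>
      obtain ⟨-, h⟩ := mem_toSet_tab.1 hu
      obtain rfl := of_decide_eq_true h
      exact .refl
    | succ N ih =>
      rw [Function.iterate_succ_apply'] at hu
      obtain ⟨-, h | ⟨h, w, -, hw, hwu⟩⟩ := mem_toSet_grow.1 hu
      · exact ih h
      · exact (ih hw).tail ⟨hwu, h⟩
  · have hstable : ∀ x ∈ toSet (I.grow S ((I.grow S)^[I.2.length] (I.tab fun u => decide (u = v)))),
        x ∈ toSet ((I.grow S)^[I.2.length] (I.tab fun u => decide (u = v))) := by
      refine iterate_stable (f := I.grow S)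
        (μ := fun R => ((Finset.range I.2.length).filter fun x => mem R x = false).card)
        (inv := fun _ => True) (p := fun R => ∀ x ∈ toSet (I.grow S R), x ∈ toSet R)
        (fun _ _ => trivial) (fun R _ => ?_) (fun R _ hR x hx => ?_) _ trivial
        ((Finset.card_filter_le _ _).trans (by simp))
      · by_cases h : ∀ x ∈ toSet (I.grow S R), x ∈ toSet R
        · exact Or.inl h
        · push Not at h
          obtain ⟨x, hx, hxR⟩ := h
          refine Or.inr (Finset.card_lt_card ((Finset.ssubset_iff_of_subset ?_).2 ⟨x, ?_, ?_⟩))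
          · intro y hy
            simp only [Finset.mem_filter, Finset.mem_range, ← Bool.not_eq_true] at hy ⊢
            exact ⟨hy.1, fun h => hy.2 (mem_toSet_grow.2 ⟨hy.1, Or.inl h⟩)⟩
          · simp only [Finset.mem_filter, Finset.mem_range, ← Bool.not_eq_true]
            exact ⟨hbound R x hx, hxR⟩
          · simp only [Finset.mem_filter, ← Bool.not_eq_true, not_and, not_not]
            exact fun _ => hx
      · rw [mem_toSet_grow] at hx ⊢
        exact ⟨hx.1, hx.2.imp (hR x) fun h =>
          ⟨h.1, h.2.imp fun w hw => ⟨hw.1, hR w hw.2.1, hw.2.2⟩⟩⟩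
    have hbase (N : ℕ) : v ∈ toSet ((I.grow S)^[N] (I.tab fun u => decide (u = v))) := by
      induction N with
      | zero => exact mem_toSet_tab.2 ⟨hv, by simp⟩
      | succ N ih =>
        rw [Function.iterate_succ_apply']
        exact mem_toSet_grow.2 ⟨hv, Or.inl ih⟩
    intro hu
    induction hu with
    | refl => exact hbase _
    | tail _ hbc ih =>
      exact hstable _ (mem_toSet_grow.2 ⟨hI.lt hbc.1, Or.inr ⟨hbc.2, _, hI.lt (hI.symm hbc.1),
        ih, hbc.1⟩⟩)

theorem Valid.lt_of_conn {S : Set ℕ} (hI : I.Valid) (hv : v < I.2.length)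
    (h : Conn I.Adj S v u) : u < I.2.length :=
  Conn.mem_of_closed (H := {x | x < I.2.length}) (fun _ _ _ h => hI.lt h) h hv

theorem mem_toSet_area (hI : I.Valid) (hv : v < I.2.length) :
    u ∈ toSet (I.area W v) ↔ Conn I.Adj {x | x ∈ toSet W ∨ I.col x = I.col v} v u := by
  unfold area
  rw [mem_toSet_component hI hv]
  constructor <;> intro h
  · refine h.mono fun x hx => ?_
    simpa [toSet] using (mem_toSet_tab.1 hx).2
  · induction h with
    | refl => exact .refl
    | tail _ hbc ih =>
      exact .tail ih ⟨hbc.1, mem_toSet_tab.2 ⟨hI.lt hbc.1, by simpa [toSet] using hbc.2⟩⟩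

theorem toSet_advance (hI : I.Valid) (hv : v < I.2.length)
    (hW : ∀ x ∈ toSet W, x < I.2.length) :
    toSet (I.advance W v) = step I.Adj I.col (toSet W) v := by
  ext u
  unfold advance
  rw [mem_toSet_tab]
  have h := mem_toSet_area (u := u) (W := W) hI hv
  simp only [Bool.or_eq_true]
  change _ ∧ (u ∈ toSet W ∨ u ∈ toSet (I.area W v)) ↔ u ∈ toSet W ∨ Conn _ _ v u
  rw [h]
  exact ⟨fun h => h.2, fun h => ⟨h.elim (hW u) (hI.lt_of_conn hv), h⟩⟩

theorem toSet_finished (hI : I.Valid) (hQ : I.Pivots Q) :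
    toSet (I.finished Q) = run I.Adj I.col ∅ Q ∧ ∀ x ∈ toSet (I.finished Q), x < I.2.length := by
  induction Q using List.reverseRecOn with
  | nil =>
    have h : toSet (I.finished []) = ∅ := by
      ext x
      exact iff_of_false (fun h => by simpa using (mem_toSet_tab.1 h).2) (Set.notMem_empty x)
    exact ⟨h, by simp [h]⟩
  | append_singleton Q q ih =>
    obtain ⟨h1, h2⟩ := ih fun x hx => hQ x (by simp [hx])
    have h3 : I.finished (Q ++ [q]) = I.advance (I.finished Q) q := List.foldl_append
    have hq := hQ q (by simp)
    rw [h3, run_append, ← h1]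
    exact ⟨toSet_advance hI hq h2, fun x hx => (mem_toSet_tab.1 hx).1⟩

theorem covers_iff (hI : I.Valid) (hQ : I.Pivots Q) (hT : ∀ x ∈ toSet T, x < I.2.length) :
    I.covers T Q = true ↔ toSet T ⊆ run I.Adj I.col ∅ Q := by
  rw [← (toSet_finished hI hQ).1]
  simp only [covers, List.all_eq_true, mem_verts, Bool.or_eq_true, Bool.not_eq_true']
  constructor
  · intro h x hx
    exact (h x (hT x hx)).resolve_left (by simpa [toSet] using hx)
  · intro h x _
    by_cases hx : mem T x = true
    · exact Or.inr (h hx)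
    · exact Or.inl (by simpa using hx)

theorem completes_iff (hI : I.Valid) (hQ : I.Pivots Q) (hT : ∀ x ∈ toSet T, x < I.2.length)
    (hv : v < I.2.length) : I.completes T (I.finished Q) v = true ↔
      v ∈ toSet T ∧ v ∉ run I.Adj I.col ∅ Q ∧ ∀ x ∈ toSet T, I.col x = I.col v →
        x ∈ step I.Adj I.col (run I.Adj I.col ∅ Q) v := by
  have h1 := toSet_finished hI hQ
  rw [← h1.1, ← toSet_advance hI hv h1.2]
  simp only [completes, Bool.and_eq_true, List.all_eq_true, mem_verts, Bool.or_eq_true,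
    Bool.not_eq_true', Bool.and_eq_false_iff, decide_eq_false_iff_not]
  refine and_congr Iff.rfl (and_congr (by simp [toSet]) ⟨fun h x hx hc => ?_, fun h x hx => ?_⟩)
  · refine (h x (hT x hx)).resolve_left ?_
    rintro (h | h)
    · simp [toSet, h] at hx
    · exact h hc
  · by_cases hxT : mem T x = true
    · by_cases hc : I.col x = I.col v
      · exact Or.inr (h x hxT hc)
      · exact Or.inl (Or.inr hc)
    · exact Or.inl (Or.inl (by simpa using hxT))

/-- `R` results from `Q` by appending pivots that complete colours. -/
structure Extends (I : Instance) (T : Set ℕ) (Q R : List ℕ) : Prop where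
  pivots : I.Pivots Q → I.Pivots R
  subset : run I.Adj I.col ∅ Q ⊆ run I.Adj I.col ∅ R
  length : R.length + missing I.col T (run I.Adj I.col ∅ R) ≤
    Q.length + missing I.col T (run I.Adj I.col ∅ Q)

theorem Extends.refl {T : Set ℕ} : I.Extends T Q Q := ⟨fun h => h, subset_rfl, le_rfl⟩

theorem Extends.trans {T : Set ℕ} {Q R S : List ℕ} (h : I.Extends T Q R) (h' : I.Extends T R S) :
    I.Extends T Q S :=
  ⟨fun hQ => h'.pivots (h.pivots hQ), h.subset.trans h'.subset, h'.length.trans h.length⟩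

theorem finite_toSet (hT : ∀ x ∈ toSet T, x < I.2.length) : (toSet T).Finite :=
  (Set.finite_Iio I.2.length).subset hT

theorem closeAt_extends (hI : I.Valid) (hQ : I.Pivots Q) (hT : ∀ x ∈ toSet T, x < I.2.length)
    (hv : v < I.2.length) : I.Extends (toSet T) Q (I.closeAt T Q v) ∧
      (I.completes T (I.finished Q) v = true →
        missing I.col (toSet T) (run I.Adj I.col ∅ (I.closeAt T Q v)) <
          missing I.col (toSet T) (run I.Adj I.col ∅ Q)) := by
  by_cases h : I.completes T (I.finished Q) v = true
  · obtain ⟨h1, h2, h3⟩ := (completes_iff hI hQ hT hv).1 h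
    have h4 := succ_missing_le (A := I.Adj) (c := I.col) (finite_toSet hT) h1 h2 h3
    have h5 : run I.Adj I.col ∅ (Q ++ [v]) = step I.Adj I.col (run I.Adj I.col ∅ Q) v :=
      run_append Q [v]
    rw [closeAt, if_pos h]
    refine ⟨⟨fun _ q hq => ?_, ?_, ?_⟩, fun _ => ?_⟩
    · rcases List.mem_append.1 hq with hq | hq
      · exact hQ q hq
      · rwa [List.mem_singleton.1 hq]
    · rw [h5]; exact subset_step
    · rw [h5, List.length_append, List.length_singleton]; omega
    · rw [h5]; omega
  · rw [closeAt, if_neg h]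
    exact ⟨.refl, fun h' => absurd h' h⟩

theorem foldl_closeAt_extends (hI : I.Valid) (hT : ∀ x ∈ toSet T, x < I.2.length) {l : List ℕ}
    (hl : ∀ v ∈ l, v < I.2.length) (hQ : I.Pivots Q) :
    I.Extends (toSet T) Q (l.foldl (I.closeAt T) Q) ∧
      ((∀ v ∈ l, ¬ I.completes T (I.finished Q) v = true) → l.foldl (I.closeAt T) Q = Q) ∧
      ((∀ v ∈ l, ¬ I.completes T (I.finished Q) v = true) ∨
        missing I.col (toSet T) (run I.Adj I.col ∅ (l.foldl (I.closeAt T) Q)) <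
          missing I.col (toSet T) (run I.Adj I.col ∅ Q)) := by
  induction l generalizing Q with
  | nil => exact ⟨.refl, fun _ => rfl, Or.inl (by simp)⟩
  | cons v l ih =>
    obtain ⟨h1, h2⟩ := closeAt_extends hI hQ hT (hl v (by simp))
    obtain ⟨h3, h3', h4⟩ := ih (fun u hu => hl u (by simp [hu])) (h1.pivots hQ)
    refine ⟨h1.trans h3, ?_⟩
    rw [List.foldl_cons]
    by_cases h : I.completes T (I.finished Q) v = true
    · exact ⟨fun h' => absurd h (h' v (by simp)),
        Or.inr ((missing_anti (finite_toSet hT) h3.subset).trans_lt (h2 h))⟩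
    · have hQv : I.closeAt T Q v = Q := if_neg h
      rw [hQv] at h3' h4 ⊢
      exact ⟨fun h5 => h3' fun u hu => h5 u (by simp [hu]),
        h4.imp_left fun h5 => by simpa [h] using h5⟩

/-- After closing, no pivot completes a colour. -/
theorem close_spec (hI : I.Valid) (hT : ∀ x ∈ toSet T, x < I.2.length) (hQ : I.Pivots Q) :
    I.Extends (toSet T) Q (I.close T Q) ∧
      ∀ v ∈ toSet T, v ∉ run I.Adj I.col ∅ (I.close T Q) → ¬ ∀ x ∈ toSet T, I.col x = I.col v →
        x ∈ step I.Adj I.col (run I.Adj I.col ∅ (I.close T Q)) v := by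
  have hpass (Q : List ℕ) (hQ : I.Pivots Q) :=
    foldl_closeAt_extends hI hT (l := I.verts) (fun v hv => mem_verts.1 hv) hQ
  have hfold : I.close T Q = (I.verts.foldl (I.closeAt T))^[I.2.length] Q := by
    unfold close
    rw [List.foldl_const, length_verts]
  have hext : I.Extends (toSet T) Q (I.close T Q) := by
    rw [hfold]
    generalize I.2.length = N
    induction N with
    | zero => exact .refl
    | succ N ih =>
      rw [Function.iterate_succ_apply']
      exact ih.trans (hpass _ (ih.pivots hQ)).1
  refine ⟨hext, ?_⟩
  have hstable : ∀ v ∈ I.verts, ¬ I.completes T (I.finished (I.close T Q)) v = true := by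
    rw [hfold]
    refine iterate_stable
      (μ := fun Q => missing I.col (toSet T) (run I.Adj I.col ∅ Q)) (inv := I.Pivots)
      (p := fun Q => ∀ v ∈ I.verts, ¬ I.completes T (I.finished Q) v = true)
      (fun Q hQ => (hpass Q hQ).1.pivots hQ) (fun Q hQ => (hpass Q hQ).2.2)
      (fun Q hQ h => ?_) _ hQ ?_
    · rwa [(hpass Q hQ).2.1 h]
    · refine (Set.ncard_image_le ((finite_toSet hT).sdiff)).trans ?_
      refine (Set.ncard_le_ncard (t := Set.Iio I.2.length) (fun x hx => hT x hx.1)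
        (Set.finite_Iio _)).trans ?_
      simp [Set.ncard_eq_toFinset_card']
  intro v hvT hv hall
  exact hstable v (mem_verts.2 (hT v hvT))
    ((completes_iff hI (hext.pivots hQ) hT (hT v hvT)).2 ⟨hvT, hv, hall⟩)


theorem better_iff (Q R : List ℕ) : I.better T Q R = true ↔
    (if I.covers T Q then (Q.length : WithTop ℕ) else ⊤) <
      if I.covers T R then (R.length : WithTop ℕ) else ⊤ := by
  unfold better
  cases I.covers T Q <;> cases I.covers T R <;> simp

theorem select_better_spec {s : List ℕ} {l : List (List ℕ)} {Q : List ℕ} (hQ : Q ∈ s :: l)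
    (hc : I.covers T Q = true) : I.covers T (select (I.better T) s l) = true ∧
      (select (I.better T) s l).length ≤ Q.length := by
  have h := select_le (r := I.better T) _ better_iff s l Q hQ
  simp only [hc, if_true] at h
  cases hs : I.covers T (select (I.better T) s l) with
  | false => simp [hs] at h
  | true => simpa [hs] using h

theorem best_pivots (hI : I.Valid) (hT : ∀ x ∈ toSet T, x < I.2.length) (d : ℕ)
    (hQ : I.Pivots Q) : I.Pivots (I.best T d Q) := by
  induction d generalizing Q with
  | zero => exact (close_spec hI hT hQ).1.pivots hQ
  | succ d ih =>
    have hc := (close_spec hI hT hQ).1.pivots hQ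
    rcases List.mem_cons.1 (select_mem (I.better T) (I.close T Q)
      (I.verts.map fun v => I.best T d (I.close T Q ++ [v]))) with h | h
    · rw [best, h]; exact hc
    · obtain ⟨v, hv, h⟩ := List.mem_map.1 h
      rw [best, ← h]
      refine ih fun q hq => ?_
      rcases List.mem_append.1 hq with hq | hq
      · exact hc q hq
      · rw [List.mem_singleton.1 hq]; exact mem_verts.1 hv

theorem best_subset (hI : I.Valid) (hT : ∀ x ∈ toSet T, x < I.2.length) (d : ℕ)
    (hQ : I.Pivots Q) : run I.Adj I.col ∅ Q ⊆ run I.Adj I.col ∅ (I.best T d Q) := by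
  induction d generalizing Q with
  | zero => exact (close_spec hI hT hQ).1.subset
  | succ d ih =>
    have hext := (close_spec hI hT hQ).1
    rcases List.mem_cons.1 (select_mem (I.better T) (I.close T Q)
      (I.verts.map fun v => I.best T d (I.close T Q ++ [v]))) with h | h
    · rw [best, h]; exact hext.subset
    · obtain ⟨v, hv, h⟩ := List.mem_map.1 h
      rw [best, ← h]
      refine hext.subset.trans (Set.Subset.trans ?_ (ih fun q hq => ?_))
      · rw [run_append]; exact subset_run _
      · rcases List.mem_append.1 hq with hq | hq
        · exact hext.pivots hQ q hq
        · rw [List.mem_singleton.1 hq]; exact mem_verts.1 hv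

/-- The search with `d` free pivots finds a sequence that covers `T` whenever there is one with at
most `d` pivots more than there are colours missing, and it uses no more extra pivots. -/
theorem best_spec (hI : I.Valid) {H : Set ℕ} (hH : ∀ a b, a ∈ H → I.Adj a b → b ∈ H)
    (hHlt : ∀ x ∈ H, x < I.2.length) (hT : ∀ x ∈ toSet T, x < I.2.length)
    (hTH : ∀ u ∈ H, ∀ w ∈ toSet T, I.col u = I.col w → u ∈ toSet T) (d : ℕ) (hQ : I.Pivots Q)
    {W : Set ℕ} (hW : W ⊆ run I.Adj I.col ∅ Q) {R : List ℕ} (hR : ∀ q ∈ R, q ∈ H)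
    (hTR : toSet T ⊆ run I.Adj I.col W R)
    (hd : R.length ≤ missing I.col (toSet T) W + d) :
    I.covers T (I.best T d Q) = true ∧
      (I.best T d Q).length + missing I.col (toSet T) W ≤
        Q.length + missing I.col (toSet T) (run I.Adj I.col ∅ Q) + R.length := by
  have hTf := finite_toSet hT
  induction d generalizing Q W R with
  | zero =>
    obtain ⟨hext, hclosed⟩ := close_spec hI hT hQ
    have hWR := missing_le_length hTf R hTR
    have hlen := hext.length
    rw [best, covers_iff hI (hext.pivots hQ) hT]
    by_cases hc : toSet T ⊆ run I.Adj I.col ∅ (I.close T Q)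
    · exact ⟨hc, by omega⟩
    · obtain ⟨u, -, W₁, R₁, -, -, h1, h2⟩ := exists_pivot_of_not_subset hI.symm hH hTf hTH
        (hW.trans hext.subset) hclosed hR hTR hc
      have := missing_le_length hTf R₁ h1
      omega
  | succ d ih =>
    obtain ⟨hext, hclosed⟩ := close_spec hI hT hQ
    have hWR := missing_le_length hTf R hTR
    have hlen := hext.length
    rw [best]
    by_cases hc : toSet T ⊆ run I.Adj I.col ∅ (I.close T Q)
    · obtain ⟨h1, h2⟩ := select_better_spec (s := I.close T Q)
        (l := I.verts.map fun v => I.best T d (I.close T Q ++ [v])) List.mem_cons_self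
        ((covers_iff hI (hext.pivots hQ) hT).2 hc)
      exact ⟨h1, by omega⟩
    · obtain ⟨u, hu, W₁, R₁, hW₁, hR₁, h1, h2⟩ := exists_pivot_of_not_subset hI.symm hH hTf hTH
        (hW.trans hext.subset) hclosed hR hTR hc
      have hrun : run I.Adj I.col ∅ (I.close T Q ++ [u]) =
        step I.Adj I.col (run I.Adj I.col ∅ (I.close T Q)) u := run_append _ [u]
      have hpiv : I.Pivots (I.close T Q ++ [u]) := fun q hq => by
        rcases List.mem_append.1 hq with hq | hq
        · exact hext.pivots hQ q hq
        · rw [List.mem_singleton.1 hq]; exact hHlt u hu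
      obtain ⟨h3, h4⟩ := ih hpiv (hrun ▸ hW₁) hR₁ h1 (by omega)
      obtain ⟨h5, h6⟩ := select_better_spec (s := I.close T Q)
        (l := I.verts.map fun v => I.best T d (I.close T Q ++ [v]))
        (List.mem_cons_of_mem _ (List.mem_map.2 ⟨u, mem_verts.2 (hHlt u hu), rfl⟩)) h3
      refine ⟨h5, ?_⟩
      have h7 : missing I.col (toSet T) (run I.Adj I.col ∅ (I.close T Q ++ [u])) ≤
          missing I.col (toSet T) (run I.Adj I.col ∅ (I.close T Q)) :=
        missing_anti hTf (by rw [hrun]; exact subset_step)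
      rw [List.length_append, List.length_singleton] at h4
      omega

/-- Every connected component has a connected dominating set of at most four vertices. -/
def SmallDomination (I : Instance) : Prop :=
  ∀ v < I.2.length, ∃ D : List ℕ, D.length ≤ 4 ∧ (∀ a ∈ D, Conn I.Adj Set.univ v a) ∧
    (∀ a ∈ D, ∀ b ∈ D, Conn I.Adj {x | x ∈ D} a b) ∧
    ∀ u, Conn I.Adj Set.univ v u → u ∈ D ∨ ∃ a ∈ D, I.Adj a u

theorem mem_toSet_target (hI : I.Valid) (hv : v < I.2.length) :
    u ∈ toSet (I.target T v) ↔ u < I.2.length ∧ u ∈ toSet T ∧ Conn I.Adj Set.univ v u := by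
  unfold target
  rw [mem_toSet_tab, Bool.and_eq_true]
  refine and_congr Iff.rfl (and_congr Iff.rfl
    ((mem_toSet_component hI hv).trans ⟨fun h => h.mono (Set.subset_univ _), fun h => ?_⟩))
  induction h with
  | refl => exact .refl
  | tail _ hbc ih => exact .tail ih ⟨hbc.1, mem_toSet_tab.2 ⟨hI.lt hbc.1, rfl⟩⟩

theorem best_target_spec (hI : I.Valid) (hD : I.SmallDomination)
    (hTs : ∀ u < I.2.length, ∀ w ∈ toSet T, I.col u = I.col w → u ∈ toSet T)
    (hv : v < I.2.length) (hQ : I.Pivots Q) :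
    I.covers (I.target T v) (I.best (I.target T v) 4 Q) = true ∧
      ∀ R : List ℕ, (∀ q ∈ R, Conn I.Adj Set.univ v q) →
        toSet (I.target T v) ⊆ run I.Adj I.col ∅ R →
        (I.best (I.target T v) 4 Q).length ≤ Q.length + R.length := by
  have hT : ∀ x ∈ toSet (I.target T v), x < I.2.length :=
    fun x hx => ((mem_toSet_target hI hv).1 hx).1
  have hTH : ∀ u ∈ {u | Conn I.Adj Set.univ v u}, ∀ w ∈ toSet (I.target T v),
      I.col u = I.col w → u ∈ toSet (I.target T v) := fun u hu w hw huw =>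
    (mem_toSet_target hI hv).2 ⟨hI.lt_of_conn hv hu, hTs u (hI.lt_of_conn hv hu) w
      ((mem_toSet_target hI hv).1 hw).2.1 huw, hu⟩
  have hbest (R : List ℕ) (hR : ∀ q ∈ R, Conn I.Adj Set.univ v q)
      (hTR : toSet (I.target T v) ⊆ run I.Adj I.col ∅ R)
      (h4 : R.length ≤ missing I.col (toSet (I.target T v)) ∅ + 4) :=
    best_spec hI (H := {u | Conn I.Adj Set.univ v u})
      (fun a b ha hab => Relation.ReflTransGen.tail ha ⟨hab, trivial⟩)
      (fun x hx => hI.lt_of_conn hv hx) hT hTH 4 hQ (Set.empty_subset _) hR hTR h4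
  obtain ⟨D, hD4, hvD, hDc, hDd⟩ := hD v hv
  obtain ⟨R₀, hR₀, hR₀l, hR₀T⟩ := exists_pivots_of_dominating (c := I.col)
    (H := {u | Conn I.Adj Set.univ v u}) hI.symm (finite_toSet hT)
    (fun x hx => ((mem_toSet_target hI hv).1 hx).2.2) hDc hDd ∅
  obtain ⟨h1, h2⟩ := hbest R₀ (fun q hq => (hR₀ q hq).elim (hvD q)
    fun h => ((mem_toSet_target hI hv).1 h).2.2) hR₀T (by omega)
  have h3 : missing I.col (toSet (I.target T v)) (run I.Adj I.col ∅ Q) ≤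
    missing I.col (toSet (I.target T v)) ∅ := missing_anti (finite_toSet hT) (Set.empty_subset _)
  refine ⟨h1, fun R hR hTR => ?_⟩
  by_cases h4 : R.length ≤ missing I.col (toSet (I.target T v)) ∅ + 4
  · have := (hbest R hR hTR h4).2
    omega
  · omega

/-- The components of the graph are independent of each other, so the shortest sequences for them
add up to a shortest sequence. -/
theorem cover_spec (hI : I.Valid) (hD : I.SmallDomination)
    (hT : ∀ x ∈ toSet T, x < I.2.length)
    (hTs : ∀ u < I.2.length, ∀ w ∈ toSet T, I.col u = I.col w → u ∈ toSet T) :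
    I.Pivots (I.cover T) ∧ toSet T ⊆ run I.Adj I.col ∅ (I.cover T) ∧
      ∀ R : List ℕ, toSet T ⊆ run I.Adj I.col ∅ R → (I.cover T).length ≤ R.length := by
  classical
  have hconnsymm {a b : ℕ} (h : Conn I.Adj Set.univ a b) : Conn I.Adj Set.univ b a :=
    h.symm hI.symm trivial
  have key (l : List ℕ) (hl : ∀ v ∈ l, v < I.2.length) :
      ∃ Q, Q = l.foldl (fun Q v => if I.covers (I.target T v) Q then Q
          else I.best (I.target T v) 4 Q) [] ∧ I.Pivots Q ∧
        (∀ x ∈ toSet T, (∃ v ∈ l, Conn I.Adj Set.univ v x) → x ∈ run I.Adj I.col ∅ Q) ∧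
        ∀ R : List ℕ, toSet T ⊆ run I.Adj I.col ∅ R →
          Q.length ≤ (R.filter fun q => ∃ v ∈ l, Conn I.Adj Set.univ v q).length := by
    induction l using List.reverseRecOn with
    | nil => exact ⟨[], rfl, by simp [Pivots], by simp, by simp⟩
    | append_singleton l v ih =>
      obtain ⟨Q, hQl, hQ, hQT, hQR⟩ := ih fun u hu => hl u (by simp [hu])
      have hv := hl v (by simp)
      have hTv : ∀ x ∈ toSet (I.target T v), x < I.2.length :=
        fun x hx => ((mem_toSet_target hI hv).1 hx).1
      refine ⟨_, rfl, ?_⟩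
      rw [List.foldl_append, ← hQl]
      simp only [List.foldl_cons, List.foldl_nil]
      by_cases hc : I.covers (I.target T v) Q = true
      · rw [if_pos hc]
        refine ⟨hQ, ?_, fun R hR => (hQR R hR).trans ?_⟩
        · rintro x hx ⟨u, hu, hux⟩
          rcases List.mem_append.1 hu with hu | hu
          · exact hQT x hx ⟨u, hu, hux⟩
          · rw [List.mem_singleton.1 hu] at hux
            exact (covers_iff hI hQ hTv).1 hc ((mem_toSet_target hI hv).2 ⟨hT x hx, hx, hux⟩)
        · rw [← List.countP_eq_length_filter, ← List.countP_eq_length_filter]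
          refine List.countP_mono_left fun q _ hq => ?_
          simp only [decide_eq_true_eq] at hq ⊢
          obtain ⟨u, hu, huq⟩ := hq
          exact ⟨u, by simp [hu], huq⟩
      · rw [if_neg hc]
        obtain ⟨h1, h2⟩ := best_target_spec hI hD hTs hv hQ
        have hP := best_pivots hI hTv 4 hQ
        refine ⟨hP, ?_, fun R hR => ?_⟩
        · rintro x hx ⟨u, hu, hux⟩
          rcases List.mem_append.1 hu with hu | hu
          · exact best_subset hI hTv 4 hQ (hQT x hx ⟨u, hu, hux⟩)
          · rw [List.mem_singleton.1 hu] at hux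
            exact (covers_iff hI hP hTv).1 h1 ((mem_toSet_target hI hv).2 ⟨hT x hx, hx, hux⟩)
        · have hnew : ∀ q, Conn I.Adj Set.univ v q → ¬ ∃ u ∈ l, Conn I.Adj Set.univ u q := by
            -- Otherwise the component of `v` has been covered before.
            rintro q hq ⟨u, hu, huq⟩
            refine hc ((covers_iff hI hQ hTv).2 fun x hx => ?_)
            obtain ⟨-, hx, hvx⟩ := (mem_toSet_target hI hv).1 hx
            exact hQT x hx ⟨u, hu, (huq.trans (hconnsymm hq)).trans hvx⟩
          have h3 := h2 (R.filter fun q => Conn I.Adj Set.univ v q) (by simp) fun x hx => by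
            obtain ⟨-, hxT, hvx⟩ := (mem_toSet_target hI hv).1 hx
            exact run_inter_subset_run_filter (H := {q | Conn I.Adj Set.univ v q}) hI.symm
              (fun a b ha hab => Relation.ReflTransGen.tail ha ⟨hab, trivial⟩) R (by simp)
              ⟨hR hxT, hvx⟩
          have h4 := hQR R hR
          refine h3.trans ((Nat.add_le_add_right h4 _).trans (le_of_eq ?_))
          clear h2 h3 h4 hR
          induction R with
          | nil => simp
          | cons q R ihR =>
            have := hnew q
            by_cases h5 : Conn I.Adj Set.univ v q
            · have h6 := hnew q h5
              have h7 : ∃ u ∈ l ++ [v], Conn I.Adj Set.univ u q := ⟨v, by simp, h5⟩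
              rw [List.filter_cons_of_neg (by simpa using h6), List.filter_cons_of_pos
                (by simpa using h5), List.filter_cons_of_pos (by simpa using h7),
                List.length_cons, List.length_cons]
              omega
            · by_cases h6 : ∃ u ∈ l, Conn I.Adj Set.univ u q
              · have h7 : ∃ u ∈ l ++ [v], Conn I.Adj Set.univ u q := by
                  obtain ⟨u, hu, huq⟩ := h6
                  exact ⟨u, by simp [hu], huq⟩
                rw [List.filter_cons_of_pos (by simpa using h6), List.filter_cons_of_neg
                  (by simpa using h5), List.filter_cons_of_pos (by simpa using h7),
                  List.length_cons, List.length_cons]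
                omega
              · have h7 : ¬ ∃ u ∈ l ++ [v], Conn I.Adj Set.univ u q := by
                  rintro ⟨u, hu, huq⟩
                  rcases List.mem_append.1 hu with hu | hu
                  · exact h6 ⟨u, hu, huq⟩
                  · exact h5 (List.mem_singleton.1 hu ▸ huq)
                rw [List.filter_cons_of_neg (by simpa using h6), List.filter_cons_of_neg
                  (by simpa using h5), List.filter_cons_of_neg (by simpa using h7)]
                exact ihR
  obtain ⟨Q, hQ, h1, h2, h3⟩ := key I.verts fun v hv => mem_verts.1 hv
  have hQ' : I.cover T = Q := hQ.symm
  rw [hQ']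
  exact ⟨h1, fun x hx => h2 x hx ⟨x, mem_verts.2 (hT x hx), .refl⟩,
    fun R hR => (h3 R hR).trans (List.length_filter_le _ _)⟩

end Instance

/-! ### Encoded instances -/

section Transfer

variable {U V C C' : Type*} {A : V → V → Prop} {A' : U → U → Prop} {e : V → U} {c : V → C}
  {c' : U → C'}

theorem conn_map_iff (he : Function.Injective e)
    (hA : ∀ v x, A' (e v) x ↔ ∃ u, x = e u ∧ A v u) {S : Set U} {u v : V} :
    Conn A' S (e v) (e u) ↔ Conn A (e ⁻¹' S) v u := by
  constructor
  · have key (x : U) (h : Conn A' S (e v) x) : ∃ u, x = e u ∧ Conn A (e ⁻¹' S) v u := by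
      induction h with
      | refl => exact ⟨v, rfl, .refl⟩
      | tail _ hbc ih =>
        obtain ⟨w, rfl, hw⟩ := ih
        obtain ⟨u, rfl, hwu⟩ := (hA _ _).1 hbc.1
        exact ⟨u, rfl, hw.tail ⟨hwu, hbc.2⟩⟩
    intro h
    obtain ⟨w, hw, h⟩ := key _ h
    rwa [he hw]
  · intro h
    induction h with
    | refl => exact .refl
    | tail _ hbc ih => exact .tail ih ⟨(hA _ _).2 ⟨_, rfl, hbc.1⟩, hbc.2⟩

theorem preimage_step (he : Function.Injective e)
    (hA : ∀ v x, A' (e v) x ↔ ∃ u, x = e u ∧ A v u) (hc : ∀ u v, c' (e u) = c' (e v) ↔ c u = c v)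
    (W : Set U) (v : V) : e ⁻¹' step A' c' W (e v) = step A c (e ⁻¹' W) v := by
  ext u
  refine or_congr Iff.rfl ((conn_map_iff he hA).trans ?_)
  rw [show e ⁻¹' {x | x ∈ W ∨ c' x = c' (e v)} = {x | x ∈ e ⁻¹' W ∨ c x = c v} from
    Set.ext fun x => or_congr Iff.rfl (hc x v)]
  rfl

theorem preimage_run (he : Function.Injective e)
    (hA : ∀ v x, A' (e v) x ↔ ∃ u, x = e u ∧ A v u) (hc : ∀ u v, c' (e u) = c' (e v) ↔ c u = c v)
    (W : Set U) (Q : List V) : e ⁻¹' run A' c' W (Q.map e) = run A c (e ⁻¹' W) Q := by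
  induction Q generalizing W with
  | nil => rfl
  | cons q Q ih => exact (ih _).trans (by rw [preimage_step he hA hc]; rfl)

end Transfer

open Classical in
/-- A coloured graph as an instance of the algorithm. -/
noncomputable def code {n k : ℕ} (G : SimpleGraph (Fin n)) (t : Fin n → Fin k) : Instance :=
  (List.ofFn fun u => List.ofFn fun v => decide (v ∈ G.neighborSet u), List.ofFn fun v => (t v : ℕ))

variable {n k : ℕ} {G : SimpleGraph (Fin n)} {t : Fin n → Fin k}

theorem enc_code : enc (code G t) = encodeInstance G t := by
  simp only [code, enc_prod, encodeInstance]
  congr 1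
  · simp only [Enc.enc, List.map_ofFn, encodeSet, Function.comp_def]
    congr!
  · simp only [Enc.enc, List.map_ofFn]
    rfl

theorem length_code : (code G t).2.length = n := by simp [code]

theorem adj_code {u v : ℕ} :
    (code G t).Adj u v ↔ ∃ (hu : u < n) (hv : v < n), G.Adj ⟨u, hu⟩ ⟨v, hv⟩ := by
  unfold Instance.Adj Instance.adj Instance.mem
  by_cases hu : u < n
  · by_cases hv : v < n
    · simp [code, List.getD_eq_getElem?_getD, hu, hv]
    · simp [code, List.getD_eq_getElem?_getD, hu, hv]
  · simp [code, List.getD_eq_getElem?_getD, hu]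

theorem adj_code_iff (v : Fin n) (x : ℕ) :
    (code G t).Adj v x ↔ ∃ u : Fin n, x = u ∧ G.Adj v u := by
  rw [adj_code]
  constructor
  · rintro ⟨_, hx, h⟩
    exact ⟨⟨x, hx⟩, rfl, h⟩
  · rintro ⟨u, rfl, h⟩
    exact ⟨v.2, u.2, h⟩

theorem col_code (v : Fin n) : (code G t).col v = t v := by
  simp [code, Instance.col, List.getD_eq_getElem?_getD]

theorem col_code_eq_iff (u v : Fin n) : (code G t).col u = (code G t).col v ↔ t u = t v := by
  rw [col_code, col_code, Fin.val_inj]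

theorem valid_code : (code G t).Valid where
  symm u v h := by
    rw [adj_code] at h ⊢
    obtain ⟨hu, hv, h⟩ := h
    exact ⟨hv, hu, h.symm⟩
  lt u v h := by
    rw [length_code]
    exact (adj_code.1 h).2.1

theorem conn_code_iff {S : Set ℕ} {u v : Fin n} :
    Conn (code G t).Adj S v u ↔ Conn G.Adj (Fin.val ⁻¹' S) v u :=
  conn_map_iff Fin.val_injective adj_code_iff

theorem preimage_run_code (Q : List (Fin n)) :
    Fin.val ⁻¹' run (code G t).Adj (code G t).col ∅ (Q.map Fin.val) = run G.Adj t ∅ Q :=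
  preimage_run Fin.val_injective adj_code_iff col_code_eq_iff ∅ Q

theorem smallDomination_code (hG : CoGemFree G) : (code G t).SmallDomination := by
  intro v hv
  rw [length_code] at hv
  obtain ⟨v, rfl⟩ : ∃ w : Fin n, (w : ℕ) = v := ⟨⟨v, hv⟩, rfl⟩
  have hreach (u : Fin n) : G.Reachable v u ↔ Conn (code G t).Adj Set.univ v u := by
    rw [conn_code_iff, SimpleGraph.reachable_iff_reflTransGen]
    simp [Conn]
  obtain ⟨D, hD, h1, h2, h3⟩ := hG.exists_dominating v
  refine ⟨D.map Fin.val, by simpa using hD, ?_, ?_, ?_⟩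
  · simpa [← hreach] using h1
  · intro a ha b hb
    obtain ⟨a, ha', rfl⟩ := List.mem_map.1 ha
    obtain ⟨b, hb', rfl⟩ := List.mem_map.1 hb
    rw [conn_code_iff]
    exact (h2 a ha' b hb').mono fun x hx => List.mem_map_of_mem hx
  · intro u hu
    have hun := valid_code.lt_of_conn (by rw [length_code]; exact v.2) hu
    rw [length_code] at hun
    obtain ⟨u, rfl⟩ : ∃ w : Fin n, (w : ℕ) = u := ⟨⟨u, hun⟩, rfl⟩
    rcases h3 u ((hreach u).2 hu) with h | ⟨a, ha, h⟩
    · exact Or.inl (List.mem_map_of_mem h)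
    · exact Or.inr ⟨a, List.mem_map_of_mem ha, (adj_code_iff a u).2 ⟨u, rfl, h⟩⟩

theorem mem_toSet_tab_code {f : ℕ → Bool} (v : Fin n) :
    (v : ℕ) ∈ Instance.toSet ((code G t).tab f) ↔ f v = true := by
  rw [Instance.mem_toSet_tab, length_code]
  simp

/-- The algorithm finds a shortest sequence of pivots that covers a union of colour classes. -/
theorem cover_code (hG : CoGemFree G) {f : ℕ → Bool}
    (hf : ∀ u w : Fin n, t u = t w → f w = true → f u = true) :
    ∃ Q : List (Fin n), (code G t).cover ((code G t).tab f) = Q.map Fin.val ∧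
      (∀ v : Fin n, f v = true → v ∈ run G.Adj t ∅ Q) ∧
      ∀ R : List (Fin n), (∀ v : Fin n, f v = true → v ∈ run G.Adj t ∅ R) →
        Q.length ≤ R.length := by
  have hT : ∀ x ∈ Instance.toSet ((code G t).tab f), x < (code G t).2.length :=
    fun x hx => (Instance.mem_toSet_tab.1 hx).1
  obtain ⟨h1, h2, h3⟩ := Instance.cover_spec (T := (code G t).tab f) valid_code
    (smallDomination_code hG) hT fun u hu w hw huw => by
      have hw' := hT w hw
      rw [length_code] at hu hw'
      exact (mem_toSet_tab_code ⟨u, hu⟩).2 (hf _ ⟨w, hw'⟩ ((col_code_eq_iff ⟨u, hu⟩ ⟨w, hw'⟩).1 huw)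
        ((mem_toSet_tab_code ⟨w, hw'⟩).1 hw))
  obtain ⟨Q, hQ⟩ : ∃ Q : List (Fin n), Q.map Fin.val = (code G t).cover ((code G t).tab f) := by
    have : ∀ q ∈ (code G t).cover ((code G t).tab f), q < n := fun q hq => by
      simpa only [length_code] using h1 q hq
    lift (code G t).cover ((code G t).tab f) to List (Fin n) using this with Q
    exact ⟨Q, rfl⟩
  rw [← hQ] at h2 h3 ⊢
  refine ⟨Q, rfl, fun v hv => ?_, fun R hR => ?_⟩
  · rw [← preimage_run_code]
    exact h2 ((mem_toSet_tab_code v).2 hv)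
  · have := h3 (R.map Fin.val) fun x hx => by
      have hx' := hT x hx
      rw [length_code] at hx'
      have := hR ⟨x, hx'⟩ ((mem_toSet_tab_code ⟨x, hx'⟩).1 hx)
      rwa [← preimage_run_code] at this
    simpa using this

/-! ### Optimal paint plans -/

open Classical in
/-- A stroke as a bit vector and a number. -/
noncomputable def codeStroke (s : Stroke (Fin n) (Fin k)) : List Bool × ℕ :=
  (List.ofFn fun v => decide (v ∈ (s.area : Set (Fin n))), s.color)

theorem enc_map_codeStroke (P : List (Stroke (Fin n) (Fin k))) :
    enc (P.map codeStroke) = encodePlan P := by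
  simp only [Enc.enc, encodePlan, List.map_map]
  congr 2
  funext s
  simp only [codeStroke, Function.comp_def, encodeSet, List.map_ofFn]
  congr!

theorem length_area (I : Instance) (W : List Bool) (v : ℕ) :
    (I.area W v).length = I.2.length := by
  unfold Instance.area Instance.component
  induction I.verts using List.reverseRecOn with
  | nil => exact I.length_tab _
  | append_singleton l a _ => rw [List.foldl_append]; exact I.length_tab _

open Classical in
theorem strokes_code (Q : List (Fin n)) :
    (code G t).strokes (Q.map Fin.val) = (pivotStrokes G t ∅ Q).map codeStroke := by
  have key (Q : List (Fin n)) (W : List Bool) (hW : ∀ x ∈ Instance.toSet W, x < n)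
      (o : List (List Bool × ℕ)) :
      ((Q.map Fin.val).foldl (fun s v => ((code G t).advance s.1 v,
        ((code G t).area s.1 v, (code G t).col v) :: s.2)) (W, o)).2 =
      (pivotStrokes G t (Fin.val ⁻¹' Instance.toSet W) Q).map codeStroke ++ o := by
    induction Q generalizing W o with
    | nil => rfl
    | cons q Q ih =>
      have hq : (q : ℕ) < (code G t).2.length := by rw [length_code]; exact q.2
      have hadv := Instance.toSet_advance (W := W) valid_code hq
        (by simpa only [length_code] using hW)
      have hstep := preimage_step (c := t) Fin.val_injective (adj_code_iff (G := G) (t := t))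
        (col_code_eq_iff (G := G) (t := t)) (Instance.toSet W) q
      rw [List.map_cons, List.foldl_cons, ih, hadv, hstep]
      · simp only [pivotStrokes, List.map_append, List.map_cons, List.map_nil, List.append_assoc,
          List.cons_append, List.nil_append]
        congr 2
        refine Prod.ext ?_ (col_code q)
        refine List.ext_getElem (by simp [length_area, length_code, codeStroke]) fun i h1 h2 => ?_
        have hi : i < n := by simpa [length_area, length_code] using h1
        have h3 := Instance.mem_toSet_area (u := i) (W := W) valid_code hq
        simp only [codeStroke, List.getElem_ofFn, Set.coe_toFinset]
        rw [Bool.eq_iff_iff, decide_eq_true_eq]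
        have h5 := conn_map_iff (S := {x | x ∈ Instance.toSet W ∨ (code G t).col x =
          (code G t).col q}) (u := ⟨i, hi⟩) (v := q) Fin.val_injective
          (adj_code_iff (G := G) (t := t))
        have h6 : Fin.val ⁻¹' {x | x ∈ Instance.toSet W ∨ (code G t).col x = (code G t).col q} =
            {x : Fin n | x ∈ Fin.val ⁻¹' Instance.toSet W ∨ t x = t q} :=
          Set.ext fun x => or_congr Iff.rfl (col_code_eq_iff x q)
        rw [h6] at h5
        refine Iff.trans ?_ (h3.trans h5)
        change _ ↔ ((code G t).area W q).getD i false = true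
        rw [List.getD_eq_getElem _ _ h1]
      · intro x hx
        simpa [length_code] using (Instance.mem_toSet_tab.1 hx).1
  have h := key Q ((code G t).tab fun _ => false) (fun x hx => by
    simpa [length_code] using (Instance.mem_toSet_tab.1 hx).1) []
  rw [List.append_nil] at h
  refine h.trans ?_
  congr 2
  ext x
  simp [mem_toSet_tab_code]

theorem plan_spec (hk : 0 < k) (hG : CoGemFree G) : ∃ P : List (Stroke (Fin n) (Fin k)),
    IsOptimalPaintPlan G t P ∧ (code G t).plan = P.map codeStroke := by
  obtain ⟨Q, hQ, hrun, hmin⟩ := cover_code (t := t) (f := fun _ => true) hG fun _ _ _ _ => rfl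
  simp only [forall_const] at hrun hmin
  have hopt (P : List (Stroke (Fin n) (Fin k))) (hP : IsPaintPlan G t P) :
      Q.length ≤ P.length := by
    obtain ⟨R, hR, hRrun⟩ := exists_pivots_of_strokes (t := t) P (fun _ => none) ∅ hP.2.1
      fun v _ => congrFun hP.2.2 v
    exact (hmin R fun v => hRrun v (by simp)).trans hR
  rw [Instance.plan, hQ]
  cases Q with
  | nil =>
    have hn : ∀ v : Fin n, False := fun v => hrun v
    refine ⟨[⟨∅, ⟨0, hk⟩⟩], ⟨⟨by simp, ?_, funext fun v => (hn v).elim⟩, fun P hP => ?_⟩, ?_⟩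
    · exact fun s _ v => (hn v).elim
    · exact List.length_pos_iff.2 hP.1
    · have : n = 0 := by
        rcases Nat.eq_zero_or_pos n with h | h
        · exact h
        · exact (hn ⟨0, h⟩).elim
      subst this
      simp [codeStroke]
  | cons q Q =>
    refine ⟨pivotStrokes G t ∅ (q :: Q), ⟨⟨?_, preconnected_of_mem_pivotStrokes, ?_⟩, ?_⟩, ?_⟩
    · rw [← List.length_pos_iff, length_pivotStrokes]; simp
    · funext v
      rw [foldl_pivotStrokes _ _ (Set.notMem_empty v), if_pos (hrun v)]
    · intro P hP
      rw [length_pivotStrokes]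
      exact hopt P hP
    · rw [← strokes_code]
      simp

/-! ### Optimal flooding sequences -/

theorem floodCover_code (hG : CoGemFree G) :
    ∃ Q : List (Fin n), (code G t).floodCover = Q.map Fin.val ∧
      (Fin n → ∃ v₀, ∀ u, t u ≠ t v₀ → u ∈ run G.Adj t ∅ Q) ∧
      ∀ (c : Fin k) (R : List (Fin n)), (∀ u, t u ≠ c → u ∈ run G.Adj t ∅ R) →
        Q.length ≤ R.length := by
  obtain ⟨Q₀, hQ₀, hrun₀, hmin₀⟩ := cover_code (t := t) (f := fun _ => true) hG fun _ _ _ _ => rfl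
  have hcover (v : Fin n) := cover_code (t := t)
    (f := fun u => !decide ((code G t).col u = (code G t).col v)) hG fun u w huw => by
      simp [col_code, huw]
  simp only [col_code_eq_iff, Bool.not_eq_true', decide_eq_false_iff_not] at hcover
  have hmem := select_mem (fun Q R : List ℕ => decide (Q.length < R.length))
    ((code G t).cover ((code G t).tab fun _ => true)) ((code G t).verts.map fun v =>
      (code G t).cover ((code G t).tab fun u => !decide ((code G t).col u = (code G t).col v)))
  have hle := select_le (r := fun Q R : List ℕ => decide (Q.length < R.length)) List.length
    (by simp)
    ((code G t).cover ((code G t).tab fun _ => true)) ((code G t).verts.map fun v =>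
      (code G t).cover ((code G t).tab fun u => !decide ((code G t).col u = (code G t).col v)))
  have hQ : ∃ Q : List (Fin n), (code G t).floodCover = Q.map Fin.val ∧
      (Fin n → ∃ v₀, ∀ u, t u ≠ t v₀ → u ∈ run G.Adj t ∅ Q) := by
    rcases List.mem_cons.1 hmem with h | h
    · exact ⟨Q₀, h.trans hQ₀, fun v => ⟨v, fun u _ => hrun₀ u rfl⟩⟩
    · obtain ⟨v, hv, h⟩ := List.mem_map.1 h
      rw [Instance.mem_verts, length_code] at hv
      obtain ⟨Q, hQ, hrun, -⟩ := hcover ⟨v, hv⟩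
      exact ⟨Q, h.symm.trans hQ, fun _ => ⟨⟨v, hv⟩, hrun⟩⟩
  obtain ⟨Q, hQ, hrun⟩ := hQ
  refine ⟨Q, hQ, hrun, fun c R hR => ?_⟩
  have hlen : Q.length = (code G t).floodCover.length := by rw [hQ, List.length_map]
  rw [hlen]
  by_cases hc : ∃ v, t v = c
  · obtain ⟨v, rfl⟩ := hc
    obtain ⟨Q', hQ', -, hmin⟩ := hcover v
    refine (hle _ (List.mem_cons_of_mem _ (List.mem_map.2 ⟨v, ?_, rfl⟩))).trans ?_
    · rw [Instance.mem_verts, length_code]; exact v.2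
    · rw [hQ', List.length_map]
      exact hmin R hR
  · refine (hle _ List.mem_cons_self).trans ?_
    rw [hQ₀, List.length_map]
    exact hmin₀ R fun u _ => hR u fun h => hc ⟨u, h⟩

theorem exists_floodingSequence (hG : CoGemFree G) (t : Fin n → Fin k) :
    ∃ S : List (Move (Fin n) (Fin k)), S.length ≤ (code G t).floodCover.length ∧
      (∀ m ∈ S, ∃ v, t v = m.color) ∧ IsFloodingSequence G t S := by
  obtain ⟨Q, hQ, hrun, -⟩ := floodCover_code (t := t) hG
  rw [hQ, List.length_map]
  by_cases hn : Nonempty (Fin n)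
  · obtain ⟨v⟩ := hn
    obtain ⟨v₀, h⟩ := hrun v
    obtain ⟨S, hS, hSR, hSt⟩ := exists_moves_of_strokes (t := t) (G := G) (R := Set.range t)
      (c := t v₀) ⟨v₀, rfl⟩ (pivotStrokes G t ∅ Q) exists_color_of_mem_pivotStrokes
      preconnected_of_mem_pivotStrokes (by
        funext u
        rw [foldl_pivotStrokes _ _ (Set.notMem_empty u)]
        split_ifs with hu
        · rfl
        · rw [not_not.1 (mt (h u) hu)])
    rw [length_pivotStrokes] at hS
    exact ⟨S, hS, hSR, fun u w => (hSt u).trans (hSt w).symm⟩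
  · exact ⟨[], by simp, by simp, fun u => (hn ⟨u⟩).elim⟩

theorem length_floodCover_le (hG : CoGemFree G) {t : Fin n → Fin k}
    {S : List (Move (Fin n) (Fin k))} (hS : IsFloodingSequence G t S) :
    (code G t).floodCover.length ≤ S.length := by
  obtain ⟨Q, hQ, -, hmin⟩ := floodCover_code (t := t) hG
  rw [hQ, List.length_map]
  cases Q with
  | nil => simp
  | cons q Q =>
    obtain ⟨P, hPl, hP, hPt⟩ := exists_strokes_of_moves (c := S.foldl (Move.apply G) t q) S
      fun v => hS v q
    obtain ⟨R, hR, hRrun⟩ := exists_pivots_of_strokes (t := t) P _ ∅ hP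
      fun v _ => congrFun hPt v
    exact (hmin _ R fun u hu => hRrun u (by simpa using Ne.symm hu)).trans (hR.trans hPl.le)

theorem flood_code (m : Move (Fin n) (Fin k)) :
    (code G t).flood m.pivot m.color = code G (m.apply G t) := by
  classical
  refine Prod.ext rfl ?_
  refine List.ext_getElem ?_ fun i h1 h2 => ?_
  · rw [length_code]
    exact ((code G t).length_tab _).trans length_code
  · have hi : i < n := by rwa [length_code] at h2
    have hp : (m.pivot : ℕ) < (code G t).2.length := by rw [length_code]; exact m.pivot.2
    have h3 := Instance.mem_toSet_component (u := i)
      (S := (code G t).tab fun u => decide ((code G t).col u = (code G t).col m.pivot))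
      valid_code hp
    have h4 := conn_map_iff (u := ⟨i, hi⟩) (v := m.pivot) Fin.val_injective
      (adj_code_iff (G := G) (t := t)) (S := Instance.toSet ((code G t).tab fun u =>
        decide ((code G t).col u = (code G t).col m.pivot)))
    have h5 : Fin.val ⁻¹' Instance.toSet ((code G t).tab fun u =>
        decide ((code G t).col u = (code G t).col m.pivot)) = {x | t x = t m.pivot} :=
      Set.ext fun x => by simp [mem_toSet_tab_code, col_code_eq_iff]
    rw [h5] at h4
    have h6 := h3.trans h4
    change Instance.mem _ _ = true ↔ _ at h6
    have h7 : ((code G t).flood m.pivot m.color).2[i] =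
        if Instance.mem ((code G t).component ((code G t).tab fun u =>
          decide ((code G t).col u = (code G t).col m.pivot)) m.pivot) i then (m.color : ℕ)
        else (code G t).col i := by
      simp only [Instance.flood, Instance.tab, Instance.verts, List.getElem_map,
        List.getElem_range]
      congr!
    have h8 : (code G (m.apply G t)).2[i] = ((m.apply G t ⟨i, hi⟩ : Fin k) : ℕ) := by simp [code]
    have h9 : (code G t).col i = t ⟨i, hi⟩ := col_code ⟨i, hi⟩
    rw [h7, h8, Move.apply_eq]
    simp only [h6, h9]
    split_ifs <;> rfl

/-- A best next move brings the shortest flooding sequence closer to its end. -/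
theorem floodStep_code (hG : CoGemFree G) (ht : (code G t).floodCover.length ≠ 0)
    (o : List (ℕ × ℕ)) : ∃ m : Move (Fin n) (Fin k),
      Instance.floodStep (code G t, o) =
        (code G (m.apply G t), o ++ [((m.pivot : ℕ), (m.color : ℕ))]) ∧
      (code G (m.apply G t)).floodCover.length < (code G t).floodCover.length := by
  have hcand (v u : Fin n) : (code G t).flood v ((code G t).col u) =
      code G (Move.apply G t ⟨v, t u⟩) := by
    rw [col_code, ← flood_code]
  obtain ⟨S, hSl, hSR, hS⟩ := exists_floodingSequence hG t
  have hne : S ≠ [] := by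
    rintro rfl
    exact ht (Nat.le_zero.1 (length_floodCover_le hG hS))
  obtain ⟨m, S, rfl⟩ := List.exists_cons_of_ne_nil hne
  obtain ⟨u, hu⟩ := hSR m (by simp)
  have hm : (code G (m.apply G t)).floodCover.length < (code G t).floodCover.length :=
    (length_floodCover_le (S := S) hG hS).trans_lt
      (lt_of_lt_of_le (by simp) hSl)
  let l : List (Instance × List (ℕ × ℕ)) :=
    ((code G t).verts.flatMap fun v => (code G t).verts.map fun u =>
      (v, (code G t).col u)).map fun m => ((code G t).flood m.1 m.2, o ++ [m])
  let r : Instance × List (ℕ × ℕ) → Instance × List (ℕ × ℕ) → Bool :=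
    fun a b => decide (a.1.floodCover.length < b.1.floodCover.length)
  have hverts (v : Fin n) : (v : ℕ) ∈ (code G t).verts := by
    rw [Instance.mem_verts, length_code]; exact v.2
  have hmem : ((code G t).flood m.pivot ((code G t).col u),
      o ++ [((m.pivot : ℕ), (code G t).col u)]) ∈ (code G t, o) :: l :=
    List.mem_cons_of_mem _ (List.mem_map.2 ⟨((m.pivot : ℕ), (code G t).col u),
      List.mem_flatMap.2 ⟨m.pivot, hverts _, List.mem_map.2 ⟨u, hverts u, rfl⟩⟩, rfl⟩)
  have hle := select_le (r := r) (fun a => a.1.floodCover.length) (by simp [r]) (code G t, o) l _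
    hmem
  have hlt : (select r (code G t, o) l).1.floodCover.length < (code G t).floodCover.length := by
    refine hle.trans_lt ?_
    simp only [hcand]
    rwa [show (⟨m.pivot, t u⟩ : Move (Fin n) (Fin k)) = m by rw [hu]]
  have hstep : Instance.floodStep (code G t, o) = select r (code G t, o) l := rfl
  rw [hstep]
  rcases List.mem_cons.1 (select_mem r (code G t, o) l) with h | h
  · rw [h] at hlt
    exact absurd hlt (lt_irrefl _)
  · obtain ⟨x, hx, h⟩ := List.mem_map.1 h
    obtain ⟨v, hv, hx⟩ := List.mem_flatMap.1 hx
    obtain ⟨w, hw, rfl⟩ := List.mem_map.1 hx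
    rw [Instance.mem_verts, length_code] at hv hw
    rw [← h] at hlt ⊢
    have hc := hcand ⟨v, hv⟩ ⟨w, hw⟩
    simp only at hc hlt ⊢
    rw [hc] at hlt ⊢
    exact ⟨⟨⟨v, hv⟩, t ⟨w, hw⟩⟩, by rw [← col_code (G := G)], hlt⟩

/-- A move as a pair of numbers. -/
def codeMove (m : Move (Fin n) (Fin k)) : ℕ × ℕ := (m.pivot, m.color)

theorem enc_map_codeMove (S : List (Move (Fin n) (Fin k))) :
    enc (S.map codeMove) = encodeMoves S := by
  simp only [Enc.enc, encodeMoves, List.map_map]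
  rfl

theorem moves_spec (hG : CoGemFree G) : ∃ S : List (Move (Fin n) (Fin k)),
    IsOptimalFloodingSequence G t S ∧ (code G t).moves = S.map codeMove := by
  have hzero {p : Fin n → Fin k} (hp : (code G p).floodCover.length = 0) :
      IsFloodingSequence G p [] := by
    obtain ⟨S, hSl, -, hS⟩ := exists_floodingSequence hG p
    rwa [List.length_eq_zero_iff.1 (Nat.le_zero.1 (hSl.trans hp.le))] at hS
  have key (l : List ℕ) (hl : l.length ≤ (code G t).floodCover.length) :
      ∃ S : List (Move (Fin n) (Fin k)),
        l.foldl (fun s _ => Instance.floodStep s) (code G t, []) =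
          (code G (S.foldl (Move.apply G) t), S.map codeMove) ∧ S.length = l.length ∧
        (code G (S.foldl (Move.apply G) t)).floodCover.length + l.length ≤
          (code G t).floodCover.length := by
    induction l using List.reverseRecOn with
    | nil => exact ⟨[], rfl, rfl, le_rfl⟩
    | append_singleton l a ih =>
      rw [List.length_append, List.length_singleton] at hl
      obtain ⟨S, hS, hSl, hlen⟩ := ih (by omega)
      have hne : (code G (S.foldl (Move.apply G) t)).floodCover.length ≠ 0 := fun h => by
        have := length_floodCover_le (S := S) hG (hzero h)
        omega
      obtain ⟨m, hm, hlt⟩ := floodStep_code hG hne (S.map codeMove)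
      refine ⟨S ++ [m], ?_, by simp [hSl], ?_⟩
      · rw [List.foldl_append, hS, List.foldl_append, List.map_append]
        exact hm
      · rw [List.foldl_append, List.length_append, List.length_singleton]
        change (code G (m.apply G _)).floodCover.length + _ ≤ _
        omega
  obtain ⟨S, hS, hSl, hlen⟩ := key (code G t).floodCover le_rfl
  refine ⟨S, ⟨hzero (p := S.foldl (Move.apply G) t) (by omega), fun S' hS' => ?_⟩, ?_⟩
  · rw [hSl]
    exact length_floodCover_le hG hS'
  · rw [Instance.moves, hS]

end Painting

/-- On co-gem-free graphs, an optimal paint plan for a given template, and likewise an optimal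
flooding sequence for a given initial colouring, can be computed in time polynomial in the size
of the input. -/
theorem theorem5p1 :
    (∃ (M : Painting.Prog) (q : Polynomial ℕ),
      ∀ (n k : ℕ) (_ : 0 < k) (G : SimpleGraph (Fin n)) (t : Fin n → Fin k),
        Painting.CoGemFree G →
        ∃ P : List (Painting.Stroke (Fin n) (Fin k)),
          Painting.IsOptimalPaintPlan G t P ∧
          ∃ time : ℕ, time ≤ q.eval (Painting.encodeInstance G t).size ∧
            M.Runs (Painting.encodeInstance G t) (Painting.encodePlan P) time) ∧
    (∃ (M : Painting.Prog) (q : Polynomial ℕ),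
      ∀ (n k : ℕ) (G : SimpleGraph (Fin n)) (t : Fin n → Fin k),
        Painting.CoGemFree G →
        ∃ S : List (Painting.Move (Fin n) (Fin k)),
          Painting.IsOptimalFloodingSequence G t S ∧
          ∃ time : ℕ, time ≤ q.eval (Painting.encodeInstance G t).size ∧
            M.Runs (Painting.encodeInstance G t) (Painting.encodeMoves S) time) := by
  constructor
  · obtain ⟨M, q, hM⟩ := Painting.PolyTime.plan (Painting.PolyTime.id (α := Painting.Instance))
    refine ⟨M, q, fun n k hk G t hG => ?_⟩
    obtain ⟨P, hP, hplan⟩ := Painting.plan_spec (t := t) hk hG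
    obtain ⟨time, htime, hrun⟩ := hM (Painting.code G t)
    simp only [hplan, Painting.enc_code, Painting.enc_map_codeStroke] at htime hrun
    exact ⟨P, hP, time, htime, hrun⟩
  · obtain ⟨M, q, hM⟩ := Painting.PolyTime.moves (Painting.PolyTime.id (α := Painting.Instance))
    refine ⟨M, q, fun n k G t hG => ?_⟩
    obtain ⟨S, hS, hmoves⟩ := Painting.moves_spec (t := t) hG
    obtain ⟨time, htime, hrun⟩ := hM (Painting.code G t)
    simp only [hmoves, Painting.enc_code, Painting.enc_map_codeMove] at htime hrun
    exact ⟨S, hS, time, htime, hrun⟩
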